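/- **Theorem.** Let $\mathcal H$ be a finite-dimensional complex Hilbert space, $\hbar>0$, and let $\sigma=(\lambda_1>\dots>\lambda_k>0;\,m_1,\dots,m_k)$, with integers $m_j\ge 1$ and $\sum_j m_j\lambda_j=1$. Let $\mathcal D(\sigma)$ be the set of density operators on $\mathcal H$ whose nonzero eigenvalues are exactly the $\lambda_j$, with multiplicities $m_j$. Let $\mathcal K=\mathbb C^{m_1+\dots+m_k}$, let $P(\sigma)$ be the diagonal operator on $\mathcal K$ with $m_j$ consecutive entries $\lambda_j$ for $j=1,\dots,k$, put $\mathcal S(\sigma)=\{\psi\in\mathcal L(\mathcal K,\mathcal H):\psi^\dagger\psi=P(\sigma)\}$ and $\pi:\mathcal S(\sigma)\to\mathcal D(\sigma)$, $\pi(\psi)=\psi\psi^\dagger$. Equip $\mathcal S(\sigma)$ with the metric $G(X,Y)=\tfrac12\mathrm{Tr}(X^\dagger Y+Y^\dagger X)$ (the real part of the Hilbert–Schmidt inner product), call a tangent vector of $\mathcal S(\sigma)$ horizontal if it is $G$-orthogonal to $\ker d\pi$, and let $g$ be the metric on $\mathcal D(\sigma)$ that makes $\pi$ a Riemannian submersion.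 For a $C^1$ curve $\rho:[0,T]\to\mathcal D(\sigma)$ let $\mathrm{Length}[\rho]=\int_0^T\sqrt{g(\dot\rho,\dot\rho)}\,dt$, and let $\mathrm{Dist}(\rho_0,\rho_1)$ be the infimum of the lengths of all $C^1$ curves in $\mathcal D(\sigma)$ from $\rho_0$ to $\rho_1$. Let $\rho_0,\rho_1\in\mathcal D(\sigma)$ and $\tau>0$. Consider the pairs $(\hat H,\rho)$ of a continuous family $\hat H(t)$, $t\in[0,\tau]$, of self-adjoint operators on $\mathcal H$ and a curve $\rho:[0,\tau]\to\mathcal D(\sigma)$ that solve the von Neumann boundary value problem $$\dot\rho(t)=\frac1{i\hbar}[\hat H(t),\rho(t)],\qquad \rho(0)=\rho_0,\quad \rho(\tau)=\rho_1 ,$$ and let $\Delta H(\rho)=\sqrt{\mathrm{Tr}(\hat H^2\rho)-\mathrm{Tr}(\hat H\rho)^2}$. Then such pairs exist, and 1. $\displaystyle \mathrm{Dist}(\rho_0,\rho_1)=\inf_{\hat H}\frac1\hbar\int_0^\tau\Delta H(\rho)\,dt$, the infimum being over all such pairs; 2. $\displaystyle \mathrm{Length}[\rho]\le\frac1\hbar\int_0^\tau\Delta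 H(\rho)\,dt$ for every such pair; 3. equality holds in 2 whenever $\hat H$ generates a horizontal lift of $\rho$, i.e. whenever some solution $\psi:[0,\tau]\to\mathcal S(\sigma)$ of $\dot\psi=\frac1{i\hbar}\hat H\psi$ satisfies $\pi(\psi(t))=\rho(t)$ and has horizontal velocity for all $t$; 4. if $G$ is replaced by $\hbar\,\mathrm{Tr}(X^\dagger Y+Y^\dagger X)$, the distance becomes $\sqrt{2\hbar}\,\inf_{\hat H}\frac1\hbar\int_0^\tau\Delta H(\rho)\,dt$. -/

import Mathlib

open scoped InnerProduct

namespace MixedState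

noncomputable section

/-- The spectrum `σ = (λ₁, …, λ_k; m₁, …, m_k)` of a density operator: the distinct nonzero
eigenvalues in decreasing order, with their multiplicities. -/
structure Spectrum where
  /-- number of distinct nonzero eigenvalues -/
  k : ℕ
  /-- the eigenvalues -/
  eig : Fin k → ℝ
  /-- the multiplicities -/
  mult : Fin k → ℕ
  eig_pos : ∀ j, 0 < eig j
  eig_strictAnti : StrictAnti eig
  mult_pos : ∀ j, 0 < mult j
  sum_eq_one : ∑ j, (mult j : ℝ) * eig j = 1

/-- The auxiliary Hilbert space `𝒦`, of dimension `m₁ + ⋯ + m_k`; the index `⟨j, i⟩` is the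
`i`-th basis vector of the `j`-th block. -/
abbrev Aux (σ : Spectrum) : Type :=
  EuclideanSpace ℂ (Σ j : Fin σ.k, Fin (σ.mult j))

/-- `Π_j`: the orthogonal projection of `𝒦` onto the span of the `j`-th block. -/
def blockProj (σ : Spectrum) (j : Fin σ.k) : Aux σ →L[ℂ] Aux σ :=
  ∑ i : Fin (σ.mult j),
    InnerProductSpace.rankOne ℂ (EuclideanSpace.single (⟨j, i⟩ : Σ j, Fin (σ.mult j)) (1 : ℂ))
      (EuclideanSpace.single (⟨j, i⟩ : Σ j, Fin (σ.mult j)) (1 : ℂ))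

/-- `P(σ) = ∑_j λ_j Π_j`. -/
def specOp (σ : Spectrum) : Aux σ →L[ℂ] Aux σ :=
  ∑ j, (σ.eig j : ℂ) • blockProj σ j

/-- The trace of an operator. -/
def tr {E : Type*} [NormedAddCommGroup E] [InnerProductSpace ℂ E] (A : E →L[ℂ] E) : ℂ :=
  LinearMap.trace ℂ E (A : E →ₗ[ℂ] E)

variable {H : Type*} [NormedAddCommGroup H] [InnerProductSpace ℂ H] [CompleteSpace H]

/-- `𝒟(σ)`: the density operators on `ℋ` (positive, of trace one) with spectrum `σ`. -/
def isospectral (H : Type*) [NormedAddCommGroup H] [InnerProductSpace ℂ H]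
    (σ : Spectrum) : Set (H →L[ℂ] H) :=
  {ρ | ρ.IsPositive ∧ tr ρ = 1 ∧
    (∀ j, Module.finrank ℂ (Module.End.eigenspace (ρ : H →ₗ[ℂ] H) (σ.eig j : ℂ)) = σ.mult j) ∧
    (∀ μ : ℂ, μ ≠ 0 → Module.End.HasEigenvalue (ρ : H →ₗ[ℂ] H) μ → ∃ j, μ = (σ.eig j : ℂ))}

/-- `𝒮(σ) = {ψ ∈ ℒ(𝒦, ℋ) : ψ†ψ = P(σ)}`. -/
def purifications (H : Type*) [NormedAddCommGroup H] [InnerProductSpace ℂ H] [CompleteSpace H]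
    (σ : Spectrum) : Set (Aux σ →L[ℂ] H) :=
  {ψ | ψ† ∘L ψ = specOp σ}

/-- The bundle projection `π(ψ) = ψψ†`. -/
def proj {σ : Spectrum} (ψ : Aux σ →L[ℂ] H) : H →L[ℂ] H := ψ ∘L ψ†

/-- The differential `dπ_ψ(X) = Xψ† + ψX†` of the bundle projection. -/
def dproj {σ : Spectrum} (ψ X : Aux σ →L[ℂ] H) : H →L[ℂ] H := X ∘L ψ† + ψ ∘L X†

/-- The metric `G(X, Y) = (c/2) Tr(X†Y + Y†X)` on `ℒ(𝒦, ℋ)`, that is `c` times the real part of the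
Hilbert–Schmidt inner product. -/
def hsMetric (c : ℝ) {σ : Spectrum} (X Y : Aux σ →L[ℂ] H) : ℝ :=
  c / 2 * (tr (X† ∘L Y + Y† ∘L X)).re

/-- The tangent space `T_ψ 𝒮(σ)`: the kernel of the differential of `ψ ↦ ψ†ψ`. -/
def tangent {σ : Spectrum} (ψ : Aux σ →L[ℂ] H) : Set (Aux σ →L[ℂ] H) :=
  {X | X† ∘L ψ + ψ† ∘L X = 0}

/-- The vertical space `V_ψ = ker dπ_ψ` in `T_ψ 𝒮(σ)`. -/
def vertical {σ : Spectrum} (ψ : Aux σ →L[ℂ] H) : Set (Aux σ →L[ℂ] H) :=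
  {X | X ∈ tangent ψ ∧ dproj ψ X = 0}

/-- The horizontal space: the orthogonal complement of `V_ψ` in `T_ψ 𝒮(σ)` with respect to `G`. -/
def horizontal (c : ℝ) {σ : Spectrum} (ψ : Aux σ →L[ℂ] H) : Set (Aux σ →L[ℂ] H) :=
  {X | X ∈ tangent ψ ∧ ∀ Y ∈ vertical ψ, hsMetric c X Y = 0}

open Classical in
/-- The metric `g` on `𝒟(σ)` that makes `π` a Riemannian submersion: `g_ρ(v, w) = G(X, Y)` for
horizontal vectors `X`, `Y` at a point `ψ` over `ρ` with `dπ_ψ(X) = v` and `dπ_ψ(Y) = w`.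
By `metric_dproj` below this does not depend on the choice of `ψ`, `X`, `Y`. -/
def metric (c : ℝ) (σ : Spectrum) (ρ v w : H →L[ℂ] H) : ℝ :=
  if h : ∃ r : ℝ, ∃ ψ ∈ purifications H σ, ∃ X ∈ horizontal c ψ, ∃ Y ∈ horizontal c ψ,
      proj ψ = ρ ∧ dproj ψ X = v ∧ dproj ψ Y = w ∧ r = hsMetric c X Y
  then h.choose else 0

theorem blockProj_apply (σ : Spectrum) (j : Fin σ.k) (x : Aux σ) (a : Σ j, Fin (σ.mult j)) :
    blockProj σ j x a = if a.1 = j then x a else 0 := by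
  obtain ⟨j', i'⟩ := a
  simp only [blockProj, sum_apply, InnerProductSpace.rankOne_apply,
    EuclideanSpace.inner_single_left, WithLp.ofLp_sum, Finset.sum_apply]
  by_cases h : j' = j
  · subst h
    simp
  · simp [h]

theorem specOp_apply (σ : Spectrum) (x : Aux σ) (a : Σ j, Fin (σ.mult j)) :
    specOp σ x a = (σ.eig a.1 : ℂ) * x a := by
  simp [specOp, blockProj_apply]

theorem exists_specOp_inverse (σ : Spectrum) : ∃ Q : Aux σ →L[ℂ] Aux σ,
    specOp σ ∘L Q = ContinuousLinearMap.id ℂ _ ∧ Q ∘L specOp σ = ContinuousLinearMap.id ℂ _ := by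
  have hne : ∀ j, (σ.eig j : ℂ) ≠ 0 := fun j => by exact_mod_cast (σ.eig_pos j).ne'
  refine ⟨∑ j, ((σ.eig j : ℂ))⁻¹ • blockProj σ j, ?_, ?_⟩
  · ext x a
    simp [specOp_apply, blockProj_apply, hne]
  · ext x a
    simp [specOp_apply, blockProj_apply, hne]

theorem tr_comm_comp {σ : Spectrum} (A B : Aux σ →L[ℂ] Aux σ) : tr (A ∘L B) = tr (B ∘L A) :=
  LinearMap.trace_mul_comm ℂ (A : Aux σ →ₗ[ℂ] Aux σ) B

theorem comp_eq_id_symm {σ : Spectrum} {A B : Aux σ →L[ℂ] Aux σ}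
    (h : A ∘L B = ContinuousLinearMap.id ℂ _) : B ∘L A = ContinuousLinearMap.id ℂ _ := by
  have h1 : (A : Aux σ →ₗ[ℂ] Aux σ) * (B : Aux σ →ₗ[ℂ] Aux σ) = 1 :=
    congrArg (fun C : Aux σ →L[ℂ] Aux σ => (C : Aux σ →ₗ[ℂ] Aux σ)) h
  exact ContinuousLinearMap.coe_injective (mul_eq_one_comm.1 h1)

theorem tr_add {σ : Spectrum} (A B : Aux σ →L[ℂ] Aux σ) : tr (A + B) = tr A + tr B := by
  simp [tr]

theorem eq_zero_of_hsMetric {c : ℝ} (hc : 0 < c) {σ : Spectrum} {Z : Aux σ →L[ℂ] H}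
    (h : hsMetric c Z Z = 0) : Z = 0 := by
  have h1 : tr (Z† ∘L Z) = ∑ a, ((‖Z (EuclideanSpace.basisFun _ ℂ a)‖ ^ 2 : ℝ) : ℂ) := by
    rw [tr, LinearMap.trace_eq_sum_inner _ (EuclideanSpace.basisFun _ ℂ)]
    refine Finset.sum_congr rfl fun a _ => ?_
    rw [ContinuousLinearMap.coe_coe, ContinuousLinearMap.comp_apply,
      ContinuousLinearMap.adjoint_inner_right, inner_self_eq_norm_sq_to_K]
    push_cast
    rfl
  have h2 : ∑ a, ‖Z (EuclideanSpace.basisFun _ ℂ a)‖ ^ 2 = 0 := by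
    rw [hsMetric, tr_add, h1, ← Complex.ofReal_sum, ← Complex.ofReal_add, Complex.ofReal_re] at h
    have := (mul_eq_zero.1 h).resolve_left (by positivity)
    linarith
  rw [Finset.sum_eq_zero_iff_of_nonneg (fun _ _ => by positivity)] at h2
  refine ContinuousLinearMap.coe_injective ((EuclideanSpace.basisFun _ ℂ).toBasis.ext fun a => ?_)
  have := h2 a (Finset.mem_univ a)
  simpa using this

theorem hsMetric_comp {c : ℝ} {σ : Spectrum} (X Y : Aux σ →L[ℂ] H) (U : Aux σ →L[ℂ] Aux σ) :
    hsMetric c (X ∘L U) Y = hsMetric c X (Y ∘L U†) := by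
  simp only [hsMetric, tr_add, ContinuousLinearMap.adjoint_comp, ContinuousLinearMap.adjoint_adjoint]
  rw [ContinuousLinearMap.comp_assoc, tr_comm_comp, ContinuousLinearMap.comp_assoc,
    ← ContinuousLinearMap.comp_assoc _ X U, tr_comm_comp (Y† ∘L X) U,
    ContinuousLinearMap.comp_assoc]

theorem tangent_comp {σ : Spectrum} {ψ X : Aux σ →L[ℂ] H} (hX : X ∈ tangent ψ)
    (U : Aux σ →L[ℂ] Aux σ) : X ∘L U ∈ tangent (ψ ∘L U) := by
  have h : U† ∘L (X† ∘L ψ + ψ† ∘L X) ∘L U = 0 := by rw [show _ = _ from hX]; simp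
  simpa only [tangent, Set.mem_ofPred_eq, ContinuousLinearMap.adjoint_comp,
    ContinuousLinearMap.comp_assoc, ContinuousLinearMap.add_comp,
    ContinuousLinearMap.comp_add] using h

theorem dproj_comp {σ : Spectrum} (ψ X : Aux σ →L[ℂ] H) {U : Aux σ →L[ℂ] Aux σ}
    (hU : U ∘L U† = ContinuousLinearMap.id ℂ _) : dproj (ψ ∘L U) (X ∘L U) = dproj ψ X := by
  have h (A : H →L[ℂ] Aux σ) : U ∘L U† ∘L A = A := by
    rw [← ContinuousLinearMap.comp_assoc, hU, ContinuousLinearMap.id_comp]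
  simp only [dproj, ContinuousLinearMap.adjoint_comp, ContinuousLinearMap.comp_assoc, h]

theorem horizontal_comp {c : ℝ} {σ : Spectrum} {ψ X : Aux σ →L[ℂ] H} (hX : X ∈ horizontal c ψ)
    {U : Aux σ →L[ℂ] Aux σ} (hU : U ∘L U† = ContinuousLinearMap.id ℂ _) :
    X ∘L U ∈ horizontal c (ψ ∘L U) := by
  have hU2 : U† ∘L U = ContinuousLinearMap.id ℂ _ := by
    exact comp_eq_id_symm hU
  have e : (ψ ∘L U) ∘L U† = ψ := by
    rw [ContinuousLinearMap.comp_assoc, hU, ContinuousLinearMap.comp_id]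
  refine ⟨tangent_comp hX.1 U, fun Y hY => ?_⟩
  rw [hsMetric_comp]
  refine hX.2 _ ⟨?_, ?_⟩
  · have := tangent_comp hY.1 (U†)
    rwa [e] at this
  · have := dproj_comp (ψ ∘L U) Y (U := U†) (by rw [ContinuousLinearMap.adjoint_adjoint, hU2])
    rw [e] at this
    rw [this, hY.2]

theorem dproj_injOn_horizontal {c : ℝ} (hc : 0 < c) {σ : Spectrum} {ψ X Y : Aux σ →L[ℂ] H}
    (hX : X ∈ horizontal c ψ) (hY : Y ∈ horizontal c ψ) (h : dproj ψ X = dproj ψ Y) : X = Y := by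
  have hv : X - Y ∈ vertical ψ := by
    constructor
    · have h1 : X† ∘L ψ + ψ† ∘L X = 0 := hX.1
      have h2 : Y† ∘L ψ + ψ† ∘L Y = 0 := hY.1
      change (X - Y)† ∘L ψ + ψ† ∘L (X - Y) = 0
      rw [map_sub, ContinuousLinearMap.sub_comp, ContinuousLinearMap.comp_sub,
        sub_add_sub_comm, h1, h2, sub_zero]
    · rw [dproj, map_sub, ContinuousLinearMap.sub_comp, ContinuousLinearMap.comp_sub,
        sub_add_sub_comm]
      exact sub_eq_zero.2 h
  have h3 : hsMetric c (X - Y) (X - Y) = hsMetric c X (X - Y) - hsMetric c Y (X - Y) := by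
    simp only [hsMetric, map_sub, ContinuousLinearMap.sub_comp, ContinuousLinearMap.comp_sub, tr,
      map_add, ContinuousLinearMap.toLinearMap_add, ContinuousLinearMap.toLinearMap_sub,
      Complex.add_re, Complex.sub_re]
    ring
  rw [hX.2 _ hv, hY.2 _ hv, sub_zero] at h3
  exact sub_eq_zero.1 (eq_zero_of_hsMetric hc h3)

/-- Two points of `𝒮(σ)` in the same fibre differ by a unitary of `𝒦`. -/
theorem exists_unitary_of_proj_eq {σ : Spectrum} {ψ φ : Aux σ →L[ℂ] H}
    (hψ : ψ ∈ purifications H σ) (hφ : φ ∈ purifications H σ) (h : proj ψ = proj φ) :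
    ∃ U : Aux σ →L[ℂ] Aux σ, U ∘L U† = ContinuousLinearMap.id ℂ _ ∧ ψ ∘L U = φ := by
  obtain ⟨Q, hQ, hQ2⟩ := exists_specOp_inverse σ
  have hψ : ψ† ∘L ψ = specOp σ := hψ
  have hφ : φ† ∘L φ = specOp σ := hφ
  have h : ψ ∘L ψ† = φ ∘L φ† := h
  have hP : (specOp σ)† = specOp σ := by
    rw [← hψ, ContinuousLinearMap.adjoint_comp, ContinuousLinearMap.adjoint_adjoint]
  have e1 : ψ ∘L (ψ† ∘L φ ∘L Q) = φ := by
    calc ψ ∘L (ψ† ∘L φ ∘L Q) = (ψ ∘L ψ†) ∘L φ ∘L Q := by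
          simp only [ContinuousLinearMap.comp_assoc]
      _ = φ ∘L ((φ† ∘L φ) ∘L Q) := by rw [h]; simp only [ContinuousLinearMap.comp_assoc]
      _ = φ := by rw [hφ, hQ, ContinuousLinearMap.comp_id]
  have e2 : (ψ† ∘L φ ∘L Q)† ∘L (ψ† ∘L φ ∘L Q) = ContinuousLinearMap.id ℂ _ := by
    calc (ψ† ∘L φ ∘L Q)† ∘L (ψ† ∘L φ ∘L Q)
        = Q† ∘L φ† ∘L (ψ ∘L (ψ† ∘L φ ∘L Q)) := by
          simp only [ContinuousLinearMap.adjoint_comp, ContinuousLinearMap.adjoint_adjoint,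
            ContinuousLinearMap.comp_assoc]
      _ = (specOp σ ∘L Q)† := by
          rw [e1, hφ, ContinuousLinearMap.adjoint_comp, hP]
      _ = _ := by rw [hQ]; exact ContinuousLinearMap.adjoint_id
  exact ⟨_, comp_eq_id_symm e2, e1⟩

/-- `dπ` restricted to each horizontal space is an isometry onto its image. -/
theorem metric_dproj {c : ℝ} (hc : 0 < c) {σ : Spectrum} {ψ X Y : Aux σ →L[ℂ] H}
    (hψ : ψ ∈ purifications H σ) (hX : X ∈ horizontal c ψ) (hY : Y ∈ horizontal c ψ) :
    metric c σ (proj ψ) (dproj ψ X) (dproj ψ Y) = hsMetric c X Y := by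
  have hex : ∃ r : ℝ, ∃ φ ∈ purifications H σ, ∃ X' ∈ horizontal c φ, ∃ Y' ∈ horizontal c φ,
      proj φ = proj ψ ∧ dproj φ X' = dproj ψ X ∧ dproj φ Y' = dproj ψ Y ∧ r = hsMetric c X' Y' :=
    ⟨_, ψ, hψ, X, hX, Y, hY, rfl, rfl, rfl, rfl⟩
  rw [metric, dif_pos hex]
  obtain ⟨φ, hφ, X', hX', Y', hY', hp, hx, hy, hr⟩ := hex.choose_spec
  obtain ⟨U, hU, rfl⟩ := exists_unitary_of_proj_eq hψ hφ hp.symm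
  have eX : X' = X ∘L U :=
    dproj_injOn_horizontal hc hX' (horizontal_comp hX hU) (by rw [hx, dproj_comp _ _ hU])
  have eY : Y' = Y ∘L U :=
    dproj_injOn_horizontal hc hY' (horizontal_comp hY hU) (by rw [hy, dproj_comp _ _ hU])
  rw [hr, eX, eY, hsMetric_comp, ContinuousLinearMap.comp_assoc, hU, ContinuousLinearMap.comp_id]

/-- The length `∫₀ᵀ √g(γ̇, γ̇) dt` of a curve in `𝒟(σ)`. -/
def length (c : ℝ) (σ : Spectrum) (T : ℝ) (γ : ℝ → H →L[ℂ] H) : ℝ :=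
  ∫ t in (0 : ℝ)..T, √(metric c σ (γ t) (derivWithin γ (Set.Icc 0 T) t)
    (derivWithin γ (Set.Icc 0 T) t))

/-- `γ : [0, T] → 𝒟(σ)` is a `C¹` curve from `ρ₀` to `ρ₁`. -/
structure IsCurve (σ : Spectrum) (T : ℝ) (ρ₀ ρ₁ : H →L[ℂ] H) (γ : ℝ → H →L[ℂ] H) : Prop where
  contDiffOn : ContDiffOn ℝ 1 γ (Set.Icc 0 T)
  mem : ∀ t ∈ Set.Icc 0 T, γ t ∈ isospectral H σ
  left : γ 0 = ρ₀
  right : γ T = ρ₁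

/-- The geodesic distance on `𝒟(σ)`: the infimum of the lengths of all curves joining `ρ₀` to
`ρ₁`. -/
def geodesicDist (c : ℝ) (σ : Spectrum) (ρ₀ ρ₁ : H →L[ℂ] H) : ℝ :=
  sInf {r | ∃ T : ℝ, 0 < T ∧ ∃ γ : ℝ → H →L[ℂ] H, IsCurve σ T ρ₀ ρ₁ γ ∧ r = length c σ T γ}

/-- The Hamiltonian vector field `X_H(ρ) = (1 / iħ) [Ĥ, ρ]`. -/
def hamField (ħ : ℝ) (A ρ : H →L[ℂ] H) : H →L[ℂ] H :=
  (1 / (Complex.I * (ħ : ℂ))) • (A ∘L ρ - ρ ∘L A)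

/-- The lifted vector field `X_Ĥ(ψ) = (1 / iħ) Ĥψ`. -/
def hamLift (ħ : ℝ) {σ : Spectrum} (A : H →L[ℂ] H) (ψ : Aux σ →L[ℂ] H) : Aux σ →L[ℂ] H :=
  (1 / (Complex.I * (ħ : ℂ))) • (A ∘L ψ)

/-- The uncertainty `ΔH(ρ) = √(Tr(Ĥ²ρ) − Tr(Ĥρ)²)`. -/
def uncertainty (A ρ : H →L[ℂ] H) : ℝ :=
  √((tr (A ∘L A ∘L ρ)).re - (tr (A ∘L ρ)).re ^ 2)

/-- The (time-dependent, continuous) Hamiltonian `Ĥ` and the curve `ρ : [0, τ] → 𝒟(σ)` solve the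
von Neumann boundary value problem `ρ̇ = X_H(ρ)`, `ρ(0) = ρ₀`, `ρ(τ) = ρ₁`. -/
structure IsVonNeumann (ħ : ℝ) (σ : Spectrum) (τ : ℝ) (ρ₀ ρ₁ : H →L[ℂ] H)
    (A ρ : ℝ → H →L[ℂ] H) : Prop where
  selfAdjoint : ∀ t ∈ Set.Icc 0 τ, IsSelfAdjoint (A t)
  continuousOn : ContinuousOn A (Set.Icc 0 τ)
  mem : ∀ t ∈ Set.Icc 0 τ, ρ t ∈ isospectral H σ
  eqn : ∀ t ∈ Set.Icc 0 τ, HasDerivWithinAt ρ (hamField ħ (A t) (ρ t)) (Set.Icc 0 τ) t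
  left : ρ 0 = ρ₀
  right : ρ τ = ρ₁

/-- `(1/ħ) ∫₀^τ ΔH(ρ(t)) dt`. -/
def energyIntegral (ħ τ : ℝ) (A ρ : ℝ → H →L[ℂ] H) : ℝ :=
  1 / ħ * ∫ t in (0 : ℝ)..τ, uncertainty (A t) (ρ t)

/-- `Ĥ` generates a horizontal lift of `ρ`: some solution of `ψ̇ = X_Ĥ(ψ)` in `𝒮(σ)` lies over `ρ`
and has horizontal velocity. -/
def GeneratesHorizontalLift (c ħ : ℝ) (σ : Spectrum) (τ : ℝ) (A ρ : ℝ → H →L[ℂ] H) : Prop :=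
  ∃ ψ : ℝ → Aux σ →L[ℂ] H, ∀ t ∈ Set.Icc 0 τ,
    ψ t ∈ purifications H σ ∧ proj (ψ t) = ρ t ∧
    HasDerivWithinAt ψ (hamLift ħ (A t) (ψ t)) (Set.Icc 0 τ) t ∧
    hamLift ħ (A t) (ψ t) ∈ horizontal c (ψ t)

end

end MixedState

/-! ### Spectral projections as fixed polynomials in the density operator. -/

namespace MixedState

noncomputable section

/-! At a fixed ρ with spectral projections E_a (kernel included), split a Hamiltonian as A = D + B,
with D = ∑ E_a A E_a block diagonal. D commutes with ρ, so A and B give the same velocity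
(`hamField_sub_pinching`). B moves every purification horizontally: a vertical Y satisfies ρY =
YP(σ), hence intertwines spectral projections, and only diagonal blocks of B could pair with it
(`hamLift_mem_horizontal`). A horizontal generator has mean zero, because iψ is vertical, so √g =
(√c/ħ) ΔB (`sqrt_metric_of_horizontal`). The cross terms vanish under the trace with ρ, so the
variance of A is that of B plus that of D, and √g ≤ (√c/ħ) ΔA (`sqrt_metric_le`). Integration gives
the length bound, and equality for horizontal generators.

Conversely, the velocity of a C¹ curve in 𝒟(σ) has no diagonal blocks, so inverting the commutator
with ρ block by block gives a continuous off-diagonal Hamiltonian that generates the curve and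
attains the bound (`IsCurve.length_eq`). Changing the duration to τ preserves the integral, so the
two infima coincide. Solutions exist because isospectral operators are unitarily conjugate and a
unitary is an exponential up to a phase (`exists_isVonNeumann`). The scale c of the metric enters
only through √c. -/

/-- The possible eigenvalues of a density operator with spectrum `σ`: zero and the `λ_j`. -/
def node (σ : Spectrum) : Option (Fin σ.k) → ℝ
  | none => 0
  | some j => σ.eig j

theorem node_injective (σ : Spectrum) : Function.Injective (node σ) := by
  rintro (_ | i) (_ | j) h
  · rfl
  · exact absurd h (σ.eig_pos j).ne
  · exact absurd h (σ.eig_pos i).ne'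
  · exact congrArg some (σ.eig_strictAnti.injective h)

theorem ofReal_node_injective (σ : Spectrum) :
    Function.Injective fun a => ((node σ a : ℝ) : ℂ) :=
  Complex.ofReal_injective.comp (node_injective σ)

/-- The polynomial whose value at a density operator with spectrum `σ` is its spectral projection
for the eigenvalue `node σ a`. -/
def nodePoly (σ : Spectrum) (a : Option (Fin σ.k)) : Polynomial ℂ :=
  Lagrange.basis Finset.univ (fun a => ((node σ a : ℝ) : ℂ)) a

/-- The spectral projections of `ρ`. -/
def specProj {H : Type*} [NormedAddCommGroup H] [InnerProductSpace ℂ H] (σ : Spectrum)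
    (a : Option (Fin σ.k)) (ρ : H →L[ℂ] H) : H →L[ℂ] H :=
  Polynomial.aeval ρ (nodePoly σ a)

theorem sum_nodePoly (σ : Spectrum) : ∑ a, nodePoly σ a = 1 :=
  Lagrange.sum_basis (ofReal_node_injective σ).injOn Finset.univ_nonempty

variable {H : Type*} [NormedAddCommGroup H] [InnerProductSpace ℂ H]

theorem sum_specProj (σ : Spectrum) (ρ : H →L[ℂ] H) : ∑ a, specProj σ a ρ = 1 := by
  simp only [specProj, ← map_sum, sum_nodePoly, map_one]

/-- Intertwining passes to polynomials, hence to spectral projections; it serves for ψ† and for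
vertical vectors, which intertwine ρ with P(σ). -/
theorem aeval_comp_eq_comp_aeval {E F : Type*} [NormedAddCommGroup E] [NormedSpace ℂ E]
    [NormedAddCommGroup F] [NormedSpace ℂ F] {S : E →L[ℂ] E} {T : F →L[ℂ] F} {Y : E →L[ℂ] F}
    (h : T ∘L Y = Y ∘L S) (p : Polynomial ℂ) :
    Polynomial.aeval T p ∘L Y = Y ∘L Polynomial.aeval S p := by
  induction p using Polynomial.induction_on' with
  | add p q hp hq => simp only [map_add, ContinuousLinearMap.add_comp,
      ContinuousLinearMap.comp_add, hp, hq]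
  | monomial n c =>
    have hn : (T ^ n) ∘L Y = Y ∘L (S ^ n) := by
      induction n with
      | zero => ext; simp
      | succ n ih =>
        rw [pow_succ, pow_succ]
        change (T ^ n) ∘L (T ∘L Y) = (Y ∘L (S ^ n)) ∘L S
        rw [h, ← ih]; rfl
    have e1 : Polynomial.aeval T (Polynomial.monomial n c) = c • T ^ n := by
      rw [Polynomial.aeval_monomial, Algebra.smul_def]
    have e2 : Polynomial.aeval S (Polynomial.monomial n c) = c • S ^ n := by
      rw [Polynomial.aeval_monomial, Algebra.smul_def]
    rw [e1, e2, ContinuousLinearMap.smul_comp, hn, ContinuousLinearMap.comp_smul]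

theorem aeval_apply_of_apply_eq_smul {T : H →L[ℂ] H} {μ : ℂ} {x : H} (h : T x = μ • x)
    (p : Polynomial ℂ) : Polynomial.aeval T p x = p.eval μ • x := by
  induction p using Polynomial.induction_on' with
  | add p q hp hq => simp [hp, hq, add_smul]
  | monomial n c =>
    have hn : (T ^ n) x = μ ^ n • x := by
      induction n with
      | zero => simp
      | succ n ih => rw [pow_succ, mul_apply_eq_comp, h, map_smul, ih, smul_smul, pow_succ,
          mul_comm]
    have e1 : Polynomial.aeval T (Polynomial.monomial n c) = c • T ^ n := by
      rw [Polynomial.aeval_monomial, Algebra.smul_def]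
    simp [e1, hn, smul_smul]

theorem isSelfAdjoint_of_mem_isospectral [CompleteSpace H] {σ : Spectrum} {ρ : H →L[ℂ] H}
    (h : ρ ∈ isospectral H σ) : IsSelfAdjoint ρ :=
  h.1.isSelfAdjoint

/-- Operators that agree on the eigenvectors of a density operator with spectrum `σ` are equal. -/
theorem ext_of_isospectral [FiniteDimensional ℂ H] {σ : Spectrum} {ρ : H →L[ℂ] H}
    (h : ρ ∈ isospectral H σ) {S T : H →L[ℂ] H}
    (hST : ∀ a, ∀ x, ρ x = ((node σ a : ℝ) : ℂ) • x → S x = T x) : S = T := by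
  have hsymm : (ρ : H →ₗ[ℂ] H).IsSymmetric := h.1.isSymmetric
  have htop : ⨆ μ, Module.End.eigenspace (ρ : H →ₗ[ℂ] H) μ = ⊤ :=
    (Submodule.orthogonal_eq_bot_iff).1 hsymm.orthogonalComplement_iSup_eigenspaces_eq_bot
  have hle : ⨆ μ, Module.End.eigenspace (ρ : H →ₗ[ℂ] H) μ ≤
      LinearMap.ker ((S - T : H →L[ℂ] H) : H →ₗ[ℂ] H) := by
    refine iSup_le fun μ x hx => ?_
    have hx' : ρ x = μ • x := Module.End.mem_eigenspace_iff.1 hx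
    rw [LinearMap.mem_ker, ContinuousLinearMap.coe_coe, sub_apply, sub_eq_zero]
    by_cases hx0 : x = 0
    · simp [hx0]
    by_cases hμ : μ = 0
    · exact hST none x (by simpa [node, hμ] using hx')
    · obtain ⟨j, rfl⟩ := h.2.2.2 μ hμ (Module.End.hasEigenvalue_of_hasEigenvector ⟨hx, hx0⟩)
      exact hST (some j) x hx'
  rw [htop] at hle
  ext x
  have : x ∈ LinearMap.ker ((S - T : H →L[ℂ] H) : H →ₗ[ℂ] H) := hle trivial
  simpa [sub_eq_zero] using this

section specProj

variable [FiniteDimensional ℂ H] {σ : Spectrum} {ρ : H →L[ℂ] H}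

/-- Since ρ is diagonalizable with eigenvalues among the nodes, identities between spectral
projections reduce to interpolation identities. -/
theorem aeval_eq_zero_of_eval_eq_zero (h : ρ ∈ isospectral H σ) {p : Polynomial ℂ}
    (hp : ∀ a, p.eval ((node σ a : ℝ) : ℂ) = 0) : Polynomial.aeval ρ p = 0 :=
  ext_of_isospectral h fun a x hx => by simp [aeval_apply_of_apply_eq_smul hx, hp]

theorem eval_nodePoly (σ : Spectrum) (a b : Option (Fin σ.k)) :
    (nodePoly σ a).eval ((node σ b : ℝ) : ℂ) = if a = b then 1 else 0 := by
  split_ifs with hab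
  · subst hab
    exact Lagrange.eval_basis_self (v := fun a => ((node σ a : ℝ) : ℂ))
      (ofReal_node_injective σ).injOn (Finset.mem_univ a)
  · exact Lagrange.eval_basis_of_ne (v := fun a => ((node σ a : ℝ) : ℂ)) hab (Finset.mem_univ b)

theorem specProj_mul_specProj (h : ρ ∈ isospectral H σ) (a b : Option (Fin σ.k)) :
    specProj σ a ρ * specProj σ b ρ = if a = b then specProj σ a ρ else 0 := by
  split_ifs with hab
  · subst hab
    rw [← sub_eq_zero, specProj, ← map_mul, ← map_sub]
    refine aeval_eq_zero_of_eval_eq_zero h fun c => ?_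
    rw [Polynomial.eval_sub, Polynomial.eval_mul, eval_nodePoly]
    split_ifs <;> simp
  · rw [specProj, specProj, ← map_mul]
    refine aeval_eq_zero_of_eval_eq_zero h fun c => ?_
    rw [Polynomial.eval_mul, eval_nodePoly, eval_nodePoly]
    split_ifs with h1 h2 <;> simp_all

theorem mul_specProj (h : ρ ∈ isospectral H σ) (a : Option (Fin σ.k)) :
    ρ * specProj σ a ρ = ((node σ a : ℝ) : ℂ) • specProj σ a ρ := by
  have := aeval_eq_zero_of_eval_eq_zero h
    (p := (Polynomial.X - Polynomial.C ((node σ a : ℝ) : ℂ)) * nodePoly σ a) fun b => by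
      rw [Polynomial.eval_mul, eval_nodePoly]
      split_ifs with hab <;> simp [hab]
  rwa [map_mul, map_sub, Polynomial.aeval_X, Polynomial.aeval_C, sub_mul, sub_eq_zero,
    ← Algebra.smul_def] at this

theorem specProj_mul (h : ρ ∈ isospectral H σ) (a : Option (Fin σ.k)) :
    specProj σ a ρ * ρ = ((node σ a : ℝ) : ℂ) • specProj σ a ρ := by
  rw [← mul_specProj h, specProj]
  calc Polynomial.aeval ρ (nodePoly σ a) * ρ
      = Polynomial.aeval ρ (nodePoly σ a * Polynomial.X) := by simp
    _ = Polynomial.aeval ρ (Polynomial.X * nodePoly σ a) := by rw [mul_comm]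
    _ = ρ * Polynomial.aeval ρ (nodePoly σ a) := by simp

/-- The nodes are real and distinct, so E_a* annihilates E_b for b ≠ a; multiplying E_a* by ∑ E_b =
1 leaves E_a* = E_a* E_a, which is self-adjoint. -/
theorem isSelfAdjoint_specProj [CompleteSpace H] (h : ρ ∈ isospectral H σ) (a : Option (Fin σ.k)) :
    IsSelfAdjoint (specProj σ a ρ) := by
  have h1 : star (specProj σ a ρ) * ρ = ((node σ a : ℝ) : ℂ) • star (specProj σ a ρ) := by
    have := congrArg star (mul_specProj h a)
    rwa [star_mul, (isSelfAdjoint_of_mem_isospectral h).star_eq, star_smul, Complex.star_def,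
      Complex.conj_ofReal] at this
  have h2 (b) (hb : b ≠ a) : star (specProj σ a ρ) * specProj σ b ρ = 0 := by
    have e : ((node σ a : ℝ) : ℂ) • (star (specProj σ a ρ) * specProj σ b ρ) =
        ((node σ b : ℝ) : ℂ) • (star (specProj σ a ρ) * specProj σ b ρ) := by
      rw [← smul_mul_assoc, ← h1, mul_assoc, mul_specProj h, mul_smul_comm]
    rw [← sub_eq_zero, ← sub_smul, smul_eq_zero, sub_eq_zero] at e
    exact e.resolve_left fun he => hb (ofReal_node_injective σ he).symm
  have h3 : star (specProj σ a ρ) = star (specProj σ a ρ) * specProj σ a ρ := by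
    conv_lhs => rw [← mul_one (star _), ← sum_specProj σ ρ, Finset.mul_sum]
    exact Finset.sum_eq_single a (fun b _ hb => h2 b hb) (by simp)
  have h4 : IsSelfAdjoint (star (specProj σ a ρ)) := by
    rw [h3]; exact IsSelfAdjoint.star_mul_self _
  exact isSelfAdjoint_iff.2 (by simpa using h4.star_eq.symm)

end specProj

end

/-! ### Pinching and traces. -/

noncomputable section

set_option linter.unusedSectionVars false

variable {H : Type*} [NormedAddCommGroup H] [InnerProductSpace ℂ H]

section pinching

/-- The part of `A` that is block diagonal for the spectral projections of `ρ`. -/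
def pinching (σ : Spectrum) (ρ A : H →L[ℂ] H) : H →L[ℂ] H :=
  ∑ a, specProj σ a ρ * A * specProj σ a ρ

variable [FiniteDimensional ℂ H] {σ : Spectrum} {ρ : H →L[ℂ] H}

theorem specProj_mul_pinching_mul (h : ρ ∈ isospectral H σ) (A : H →L[ℂ] H)
    (a : Option (Fin σ.k)) :
    specProj σ a ρ * pinching σ ρ A * specProj σ a ρ = specProj σ a ρ * A * specProj σ a ρ := by
  rw [pinching, Finset.mul_sum, Finset.sum_mul, Finset.sum_eq_single a]
  · have := specProj_mul_specProj h a a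
    rw [if_pos rfl] at this
    simp only [mul_assoc, this]
    simp only [← mul_assoc, this]
  · intro b _ hb
    have := specProj_mul_specProj h a b
    rw [if_neg hb.symm] at this
    simp only [← mul_assoc, this, zero_mul]
  · simp

theorem specProj_mul_pinching_comm (h : ρ ∈ isospectral H σ) (A : H →L[ℂ] H)
    (a : Option (Fin σ.k)) :
    specProj σ a ρ * pinching σ ρ A = pinching σ ρ A * specProj σ a ρ := by
  simp only [pinching, Finset.mul_sum, Finset.sum_mul]
  refine Finset.sum_congr rfl fun b _ => ?_
  rw [← mul_assoc, ← mul_assoc, specProj_mul_specProj h, mul_assoc _ _ (specProj σ a ρ),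
    specProj_mul_specProj h]
  by_cases hab : a = b
  · simp [hab]
  · simp [hab, Ne.symm hab]

theorem pinching_mul_comm (h : ρ ∈ isospectral H σ) (A : H →L[ℂ] H) :
    pinching σ ρ A * ρ = ρ * pinching σ ρ A := by
  rw [pinching, Finset.mul_sum, Finset.sum_mul]
  refine Finset.sum_congr rfl fun a _ => ?_
  rw [mul_assoc _ _ ρ, specProj_mul h, ← mul_assoc ρ, ← mul_assoc ρ, mul_specProj h,
    mul_smul_comm, smul_mul_assoc, smul_mul_assoc]

theorem isSelfAdjoint_pinching [CompleteSpace H] (h : ρ ∈ isospectral H σ) {A : H →L[ℂ] H}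
    (hA : IsSelfAdjoint A) : IsSelfAdjoint (pinching σ ρ A) := by
  rw [pinching, isSelfAdjoint_iff, star_sum]
  refine Finset.sum_congr rfl fun a _ => ?_
  rw [star_mul, star_mul, (isSelfAdjoint_specProj h a).star_eq, hA.star_eq, mul_assoc]

/-- A decomposition with respect to the spectral projections. -/
theorem sum_sum_specProj (σ : Spectrum) (ρ A : H →L[ℂ] H) :
    ∑ a, ∑ b, specProj σ a ρ * A * specProj σ b ρ = A := by
  simp_rw [← Finset.mul_sum, sum_specProj, mul_one, ← Finset.sum_mul, sum_specProj, one_mul]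

end pinching

section trace

variable {E F : Type*} [NormedAddCommGroup E] [InnerProductSpace ℂ E] [FiniteDimensional ℂ E]
  [NormedAddCommGroup F] [InnerProductSpace ℂ F] [FiniteDimensional ℂ F]

theorem tr_comp_comm (A : E →L[ℂ] F) (B : F →L[ℂ] E) : tr (A ∘L B) = tr (B ∘L A) :=
  (LinearMap.trace_comp_comm' (A : E →ₗ[ℂ] F) (B : F →ₗ[ℂ] E)).symm

theorem tr_mul_comm (A B : E →L[ℂ] E) : tr (A * B) = tr (B * A) := tr_comp_comm A B

/-- The trace as a continuous linear functional. -/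
def trL (E : Type*) [NormedAddCommGroup E] [InnerProductSpace ℂ E] [FiniteDimensional ℂ E] :
    (E →L[ℂ] E) →L[ℂ] ℂ :=
  LinearMap.toContinuousLinearMap
    ((LinearMap.trace ℂ E).comp (ContinuousLinearMap.coeLM ℂ))

theorem trL_apply (A : E →L[ℂ] E) : trL E A = tr A := rfl

variable [CompleteSpace E] [CompleteSpace F]

theorem tr_adjoint (A : E →L[ℂ] E) : tr (A†) = star (tr A) := by
  rw [tr, tr, LinearMap.trace_eq_sum_inner _ (stdOrthonormalBasis ℂ E),
    LinearMap.trace_eq_sum_inner _ (stdOrthonormalBasis ℂ E), star_sum]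
  refine Finset.sum_congr rfl fun i _ => ?_
  rw [ContinuousLinearMap.coe_coe, ContinuousLinearMap.coe_coe,
    ContinuousLinearMap.adjoint_inner_right]
  exact (inner_conj_symm _ _).symm

theorem tr_adjoint_comp_self_nonneg (A : E →L[ℂ] F) : 0 ≤ (tr (A† ∘L A)).re := by
  rw [tr, LinearMap.trace_eq_sum_inner _ (stdOrthonormalBasis ℂ E), Complex.re_sum]
  refine Finset.sum_nonneg fun i _ => ?_
  rw [ContinuousLinearMap.coe_coe, ContinuousLinearMap.comp_apply,
    ContinuousLinearMap.adjoint_inner_right]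
  exact inner_self_nonneg (𝕜 := ℂ)

end trace

/-! ### Horizontal lifts, and the pointwise comparison of speed with uncertainty. -/

section horizontal

variable [CompleteSpace H] [FiniteDimensional ℂ H] {σ : Spectrum} {ρ : H →L[ℂ] H}
  {ψ : Aux σ →L[ℂ] H}

theorem one_div_I_mul (ħ : ℝ) : 1 / (Complex.I * (ħ : ℂ)) = -((ħ⁻¹ : ℝ) * Complex.I) := by
  rw [one_div, mul_inv, Complex.inv_I]; push_cast; ring

theorem adjoint_hamLift {ħ : ℝ} {A : H →L[ℂ] H} (hA : IsSelfAdjoint A) (ψ : Aux σ →L[ℂ] H) :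
    (hamLift ħ A ψ)† = -(1 / (Complex.I * (ħ : ℂ))) • (ψ† ∘L A) := by
  rw [hamLift, map_smulₛₗ, ContinuousLinearMap.adjoint_comp, hA.adjoint_eq, one_div_I_mul]
  simp

theorem hamLift_mem_tangent (ħ : ℝ) {A : H →L[ℂ] H} (hA : IsSelfAdjoint A)
    (ψ : Aux σ →L[ℂ] H) : hamLift ħ A ψ ∈ tangent ψ := by
  change _ + _ = _
  rw [adjoint_hamLift hA, hamLift, ContinuousLinearMap.smul_comp, ContinuousLinearMap.comp_smul,
    ContinuousLinearMap.comp_assoc, neg_smul, neg_add_cancel]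

theorem dproj_hamLift (ħ : ℝ) {A : H →L[ℂ] H} (hA : IsSelfAdjoint A) (ψ : Aux σ →L[ℂ] H) :
    dproj ψ (hamLift ħ A ψ) = hamField ħ A (proj ψ) := by
  rw [dproj, adjoint_hamLift hA, hamLift, hamField, proj, ContinuousLinearMap.smul_comp,
    ContinuousLinearMap.comp_smul, neg_smul, ← sub_eq_add_neg, ← smul_sub]
  simp only [ContinuousLinearMap.comp_assoc]

theorem hsMetric_eq (c : ℝ) (X Y : Aux σ →L[ℂ] H) :
    hsMetric c X Y = c * (tr (X† ∘L Y)).re := by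
  have : Y† ∘L X = (X† ∘L Y)† := by
    rw [ContinuousLinearMap.adjoint_comp, ContinuousLinearMap.adjoint_adjoint]
  rw [hsMetric, tr_add, this, tr_adjoint, Complex.add_re, Complex.star_def, Complex.conj_re]
  ring

theorem hsMetric_hamLift_self (c ħ : ℝ) {A : H →L[ℂ] H} (hA : IsSelfAdjoint A)
    (ψ : Aux σ →L[ℂ] H) :
    hsMetric c (hamLift ħ A ψ) (hamLift ħ A ψ) = c / ħ ^ 2 * (tr (A * A * proj ψ)).re := by
  have e : (hamLift ħ A ψ)† ∘L hamLift ħ A ψ = ((ħ⁻¹ ^ 2 : ℝ) : ℂ) • (ψ† ∘L (A * A) ∘L ψ) := by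
    rw [adjoint_hamLift hA, hamLift, ContinuousLinearMap.smul_comp,
      ContinuousLinearMap.comp_smul, smul_smul, one_div_I_mul]
    congr 1
    push_cast
    linear_combination -(ħ : ℂ)⁻¹ ^ 2 * Complex.I_mul_I
  rw [hsMetric_eq, e, ← trL_apply, map_smul, trL_apply, smul_eq_mul, Complex.re_ofReal_mul,
    tr_comp_comm, proj, ContinuousLinearMap.comp_assoc]
  change c * (ħ⁻¹ ^ 2 * (tr (A * A * (ψ ∘L ψ†))).re) = _
  rw [inv_pow]; ring

/-- A Hamiltonian without block diagonal part generates a horizontal velocity. -/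
theorem hamLift_mem_horizontal (c ħ : ℝ) (hρ : proj ψ ∈ isospectral H σ)
    (hψ : ψ ∈ purifications H σ) {A : H →L[ℂ] H} (hA : IsSelfAdjoint A)
    (hd : ∀ a, specProj σ a (proj ψ) * A * specProj σ a (proj ψ) = 0) :
    hamLift ħ A ψ ∈ horizontal c ψ := by
  refine ⟨hamLift_mem_tangent ħ hA ψ, fun Y hY => ?_⟩
  have hψ' : ψ† ∘L ψ = specOp σ := hψ
  have hY1 : Y† ∘L ψ = -(ψ† ∘L Y) := eq_neg_of_add_eq_zero_left hY.1
  have hY2 : Y ∘L ψ† = -(ψ ∘L Y†) := eq_neg_of_add_eq_zero_left hY.2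
  -- Verticality and tangency combine: Yψ†ψ = −ψY†ψ = ψψ†Y.
  have hYi : proj ψ ∘L Y = Y ∘L specOp σ := by
    rw [← hψ', ← ContinuousLinearMap.comp_assoc, hY2, ContinuousLinearMap.neg_comp,
      ContinuousLinearMap.comp_assoc, hY1, ContinuousLinearMap.comp_neg, neg_neg, proj,
      ContinuousLinearMap.comp_assoc]
  have hψi : specOp σ ∘L ψ† = ψ† ∘L proj ψ := by
    rw [← hψ', proj, ContinuousLinearMap.comp_assoc]
  -- One copy of E_a = E_a² moves through Y, around the trace, and back through ψ†, so that A ends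
  -- up between two copies of E_a.
  have key (a) : tr (ψ† ∘L (A * specProj σ a (proj ψ)) ∘L Y) = 0 := by
    have h1 : specProj σ a (proj ψ) = specProj σ a (proj ψ) * specProj σ a (proj ψ) := by
      rw [specProj_mul_specProj hρ, if_pos rfl]
    have h2 := aeval_comp_eq_comp_aeval hYi (nodePoly σ a)
    have h3 := aeval_comp_eq_comp_aeval hψi (nodePoly σ a)
    calc tr (ψ† ∘L (A * specProj σ a (proj ψ)) ∘L Y)
        = tr (ψ† ∘L (A * specProj σ a (proj ψ)) ∘L (specProj σ a (proj ψ) ∘L Y)) := by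
          conv_lhs => rw [h1]
          rfl
      _ = tr ((ψ† ∘L (A * specProj σ a (proj ψ)) ∘L Y) ∘L
            Polynomial.aeval (specOp σ) (nodePoly σ a)) := by
          rw [specProj, h2]; rfl
      _ = tr ((Polynomial.aeval (specOp σ) (nodePoly σ a) ∘L ψ†) ∘L
            (A * specProj σ a (proj ψ)) ∘L Y) := by
          rw [tr_comp_comm]; rfl
      _ = tr (ψ† ∘L (specProj σ a (proj ψ) * A * specProj σ a (proj ψ)) ∘L Y) := by
          rw [h3]; rfl
      _ = 0 := by rw [hd]; simp [tr]
  have h0 : tr (ψ† ∘L A ∘L Y) = 0 := by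
    have e : ψ† ∘L A ∘L Y = ∑ a, ψ† ∘L (A * specProj σ a (proj ψ)) ∘L Y := by
      conv_lhs => rw [← mul_one A, ← sum_specProj σ (proj ψ), Finset.mul_sum]
      rw [ContinuousLinearMap.finsetSum_comp, ContinuousLinearMap.comp_finsetSum]
    rw [e, ← trL_apply, map_sum]
    exact Finset.sum_eq_zero fun a _ => key a
  rw [hsMetric_eq, adjoint_hamLift hA, ContinuousLinearMap.smul_comp, ← trL_apply, map_smul,
    trL_apply, ContinuousLinearMap.comp_assoc, h0]
  simp

/-- The phase direction iψ is tangent to the fibre, and orthogonality to it says precisely that the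
mean of A vanishes. -/
theorem tr_mul_proj_eq_zero {c ħ : ℝ} (hc : 0 < c) (hħ : 0 < ħ) {A : H →L[ℂ] H}
    (hA : IsSelfAdjoint A) (h : hamLift ħ A ψ ∈ horizontal c ψ) :
    (tr (A * proj ψ)).re = 0 := by
  have hv : Complex.I • ψ ∈ vertical ψ := by
    constructor
    · change _ + _ = _
      rw [map_smulₛₗ]
      simp
    · rw [dproj, map_smulₛₗ]
      simp
  have := h.2 _ hv
  rw [hsMetric_eq, adjoint_hamLift hA, ContinuousLinearMap.smul_comp,
    ContinuousLinearMap.comp_smul, smul_smul, ← trL_apply, map_smul, trL_apply,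
    ContinuousLinearMap.comp_assoc, tr_comp_comm, ContinuousLinearMap.comp_assoc, one_div_I_mul,
    neg_neg, mul_assoc, Complex.I_mul_I, mul_neg, mul_one, smul_eq_mul, ← Complex.ofReal_neg,
    Complex.re_ofReal_mul] at this
  have hne : -ħ⁻¹ ≠ 0 := neg_ne_zero.2 (inv_ne_zero hħ.ne')
  exact (mul_eq_zero.1 ((mul_eq_zero.1 this).resolve_left hc.ne')).resolve_left hne

/-- The lifted field is itself the horizontal representative of the velocity, so g is (c/ħ²)
Tr(A²ρ); as the mean is zero, this trace is the variance. -/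
theorem sqrt_metric_of_horizontal {c ħ : ℝ} (hc : 0 < c) (hħ : 0 < ħ) {A : H →L[ℂ] H}
    (hA : IsSelfAdjoint A) (hψ : ψ ∈ purifications H σ) (h : hamLift ħ A ψ ∈ horizontal c ψ) :
    √(metric c σ (proj ψ) (hamField ħ A (proj ψ)) (hamField ħ A (proj ψ))) =
      √c * (1 / ħ * uncertainty A (proj ψ)) := by
  have e : uncertainty A (proj ψ) = √((tr (A * A * proj ψ)).re) := by
    have := tr_mul_proj_eq_zero hc hħ hA h
    change √((tr (A * A * proj ψ)).re - (tr (A * proj ψ)).re ^ 2) = _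
    rw [this]; simp
  rw [← dproj_hamLift ħ hA, metric_dproj hc hψ h h, hsMetric_hamLift_self c ħ hA, e,
    Real.sqrt_mul (by positivity), Real.sqrt_div hc.le, Real.sqrt_sq hħ.le]
  ring

theorem hamField_sub_pinching (ħ : ℝ) (hρ : ρ ∈ isospectral H σ) (A : H →L[ℂ] H) :
    hamField ħ (A - pinching σ ρ A) ρ = hamField ħ A ρ := by
  have h : pinching σ ρ A ∘L ρ = ρ ∘L pinching σ ρ A := pinching_mul_comm hρ A
  rw [hamField, hamField, ContinuousLinearMap.sub_comp, ContinuousLinearMap.comp_sub, h,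
    sub_sub_sub_cancel_right]

/-- Inserting ∑ E_a = 1 and cycling the trace turns each summand into a multiple of Tr(E_a B E_a D).
With D = 1 it shows that B has mean zero. -/
theorem tr_mul_mul_eq_zero (hρ : ρ ∈ isospectral H σ) {B D : H →L[ℂ] H}
    (hB : ∀ a, specProj σ a ρ * B * specProj σ a ρ = 0)
    (hD : ∀ a, specProj σ a ρ * D = D * specProj σ a ρ) : tr (B * D * ρ) = 0 := by
  have e : B * D * ρ = ∑ a, B * D * ρ * specProj σ a ρ := by
    rw [← Finset.mul_sum, sum_specProj, mul_one]
  rw [e, ← trL_apply, map_sum]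
  refine Finset.sum_eq_zero fun a _ => ?_
  have h1 : specProj σ a ρ = specProj σ a ρ * specProj σ a ρ := by
    rw [specProj_mul_specProj hρ, if_pos rfl]
  rw [trL_apply, mul_assoc, mul_specProj hρ, h1, mul_smul_comm, ← trL_apply, map_smul, trL_apply,
    ← mul_assoc, tr_mul_comm, mul_assoc B, ← hD, ← mul_assoc, ← mul_assoc, hB]
  simp [tr]

/-- Removing the block diagonal part of a Hamiltonian does not increase the uncertainty. -/
theorem uncertainty_sub_pinching_le (hρ : proj ψ ∈ isospectral H σ) {A : H →L[ℂ] H}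
    (hA : IsSelfAdjoint A) :
    uncertainty (A - pinching σ (proj ψ) A) (proj ψ) ≤ uncertainty A (proj ψ) := by
  set ρ := proj ψ with hρdef
  set D := pinching σ ρ A with hD
  set B := A - D with hB
  have hDs : IsSelfAdjoint D := isSelfAdjoint_pinching hρ hA
  have hBd (a) : specProj σ a ρ * B * specProj σ a ρ = 0 := by
    rw [hB, mul_sub, sub_mul, hD, specProj_mul_pinching_mul hρ, sub_self]
  have t1 : tr (B * D * ρ) = 0 := tr_mul_mul_eq_zero hρ hBd (specProj_mul_pinching_comm hρ A)
  have t2 : tr (B * ρ) = 0 := by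
    simpa using tr_mul_mul_eq_zero hρ hBd (D := 1) (by simp)
  have t3 : tr (D * B * ρ) = 0 := by
    rw [tr_mul_comm, ← mul_assoc, ← pinching_mul_comm hρ, tr_mul_comm, ← mul_assoc, t1]
  have hAe : A = B + D := by rw [hB, sub_add_cancel]
  have s1 : tr (A * A * ρ) = tr (B * B * ρ) + tr (D * D * ρ) := by
    have : A * A * ρ = B * B * ρ + B * D * ρ + D * B * ρ + D * D * ρ := by
      rw [hAe]; noncomm_ring
    rw [this]
    simp only [← trL_apply, map_add]
    simp only [trL_apply, t1, t3, add_zero]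
  have s2 : tr (A * ρ) = tr (D * ρ) := by
    rw [hAe, add_mul, ← trL_apply, map_add, trL_apply, trL_apply, t2, zero_add]
  set d : ℝ := (tr (D * ρ)).re with hd
  -- Because Tr ρ = 1, this variance is the squared Hilbert–Schmidt norm of (D − d)ψ.
  have hpos : 0 ≤ (tr (D * D * ρ)).re - d ^ 2 := by
    have h := tr_adjoint_comp_self_nonneg ((D - (d : ℂ) • (1 : H →L[ℂ] H)) ∘L ψ)
    have hs : (D - (d : ℂ) • (1 : H →L[ℂ] H))† = D - (d : ℂ) • (1 : H →L[ℂ] H) := by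
      rw [map_sub, map_smulₛₗ, hDs.adjoint_eq, Complex.conj_ofReal]
      congr 2
      exact ContinuousLinearMap.adjoint_id
    rw [ContinuousLinearMap.adjoint_comp, hs, ContinuousLinearMap.comp_assoc, tr_comp_comm] at h
    have e : ((D - (d : ℂ) • (1 : H →L[ℂ] H)) ∘L (D - (d : ℂ) • (1 : H →L[ℂ] H)) ∘L ψ) ∘L ψ† =
        D * D * ρ - ((2 * d : ℝ) : ℂ) • (D * ρ) + ((d ^ 2 : ℝ) : ℂ) • ρ := by
      change (D - (d : ℂ) • (1 : H →L[ℂ] H)) * ((D - (d : ℂ) • (1 : H →L[ℂ] H)) * ρ) = _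
      simp only [sub_mul, mul_sub, smul_mul_assoc, one_mul, mul_smul_comm, smul_sub, smul_smul,
        mul_assoc]
      push_cast
      module
    have htr : tr ρ = 1 := hρ.2.1
    rw [e, ← trL_apply, map_add, map_sub, map_smul, map_smul, trL_apply, trL_apply, trL_apply,
      htr, smul_eq_mul, smul_eq_mul, Complex.add_re, Complex.sub_re, Complex.re_ofReal_mul,
      Complex.re_ofReal_mul, ← hd, Complex.one_re] at h
    linarith
  refine Real.sqrt_le_sqrt ?_
  change (tr (B * B * ρ)).re - (tr (B * ρ)).re ^ 2 ≤ (tr (A * A * ρ)).re - (tr (A * ρ)).re ^ 2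
  rw [s1, s2, t2, Complex.add_re, ← hd, Complex.zero_re]
  linarith

theorem sqrt_metric_le {c ħ : ℝ} (hc : 0 < c) (hħ : 0 < ħ) (hψ : ψ ∈ purifications H σ)
    (hρ : proj ψ ∈ isospectral H σ) {A : H →L[ℂ] H} (hA : IsSelfAdjoint A) :
    √(metric c σ (proj ψ) (hamField ħ A (proj ψ)) (hamField ħ A (proj ψ))) ≤
      √c * (1 / ħ * uncertainty A (proj ψ)) := by
  have hB := hA.sub (isSelfAdjoint_pinching hρ hA)
  rw [← hamField_sub_pinching ħ hρ A, sqrt_metric_of_horizontal hc hħ hB hψ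
    (hamLift_mem_horizontal c ħ hρ hψ hB fun a => by
      rw [mul_sub, sub_mul, specProj_mul_pinching_mul hρ, sub_self])]
  gcongr
  exact uncertainty_sub_pinching_le hρ hA

end horizontal

end

/-! ### Purifications, unitary conjugacy and logarithms. -/

noncomputable section

variable {H : Type*} [NormedAddCommGroup H] [InnerProductSpace ℂ H] [CompleteSpace H]
  [FiniteDimensional ℂ H]

/-- Every density operator with spectrum `σ` lies below a point of `𝒮(σ)`. -/
theorem exists_purification {σ : Spectrum} {ρ : H →L[ℂ] H} (h : ρ ∈ isospectral H σ) :
    ∃ ψ ∈ purifications H σ, proj ψ = ρ := by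
  have hsymm : (ρ : H →ₗ[ℂ] H).IsSymmetric := h.1.isSymmetric
  let b (j : Fin σ.k) : OrthonormalBasis (Fin (σ.mult j)) ℂ
      (Module.End.eigenspace (ρ : H →ₗ[ℂ] H) (σ.eig j : ℂ)) :=
    (stdOrthonormalBasis ℂ _).reindex (finCongr (h.2.2.1 j))
  let v (a : Σ j, Fin (σ.mult j)) : H := b a.1 a.2
  have hρv (a) : ρ (v a) = (σ.eig a.1 : ℂ) • v a :=
    Module.End.mem_eigenspace_iff.1 (b a.1 a.2).2
  have hinj : Function.Injective fun j => (σ.eig j : ℂ) :=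
    Complex.ofReal_injective.comp σ.eig_strictAnti.injective
  have hv : Orthonormal ℂ v :=
    (hsymm.orthogonalFamily_eigenspaces.comp hinj).orthonormal_sigma_orthonormal
      fun j => (b j).orthonormal
  let e : OrthonormalBasis (Σ j, Fin (σ.mult j)) ℂ (Aux σ) := EuclideanSpace.basisFun _ ℂ
  -- The square roots make both ψ†ψ and ψψ† carry the eigenvalues λ_j themselves.
  let ψ : Aux σ →L[ℂ] H := ∑ a, ((√(σ.eig a.1) : ℝ) : ℂ) • InnerProductSpace.rankOne ℂ (v a) (e a)
  have hψe (a) : ψ (e a) = ((√(σ.eig a.1) : ℝ) : ℂ) • v a := by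
    simp only [ψ, sum_apply, smul_apply, InnerProductSpace.rankOne_apply]
    rw [Finset.sum_eq_single a]
    · simp [e.orthonormal.1 a]
    · intro c _ hc
      simp [e.orthonormal.2 hc]
    · simp
  have hψa (x : H) : (ψ†) x = ∑ a, ((√(σ.eig a.1) : ℝ) : ℂ) • (inner ℂ (v a) x) • e a := by
    rw [← e.sum_repr' ((ψ†) x)]
    refine Finset.sum_congr rfl fun a _ => ?_
    rw [ContinuousLinearMap.adjoint_inner_right, hψe, inner_smul_left, Complex.conj_ofReal,
      smul_smul]
  have hsq (j) : ((√(σ.eig j) : ℝ) : ℂ) * ((√(σ.eig j) : ℝ) : ℂ) = (σ.eig j : ℂ) := by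
    rw [← Complex.ofReal_mul, Real.mul_self_sqrt (σ.eig_pos j).le]
  have hψρ (x : H) : ψ ((ψ†) x) = ∑ a, (σ.eig a.1 : ℂ) • (inner ℂ (v a) x) • v a := by
    rw [hψa, map_sum]
    refine Finset.sum_congr rfl fun a _ => ?_
    rw [map_smul, map_smul, hψe, smul_comm (inner ℂ (v a) x), smul_smul, hsq]
  refine ⟨ψ, ?_, ?_⟩
  · change ψ† ∘L ψ = specOp σ
    refine ContinuousLinearMap.coe_injective (e.toBasis.ext fun a => ?_)
    simp only [OrthonormalBasis.coe_toBasis, ContinuousLinearMap.coe_coe,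
      ContinuousLinearMap.comp_apply]
    rw [hψa, Finset.sum_eq_single a]
    · rw [hψe, inner_smul_right, inner_self_eq_norm_sq_to_K, hv.1, smul_smul]
      ext c
      rw [specOp_apply]
      simp only [e, EuclideanSpace.basisFun_apply, PiLp.smul_apply, smul_eq_mul]
      by_cases hc : c = a
      · subst hc; simp [← hsq]
      · simp [hc]
    · intro c _ hc
      rw [hψe, inner_smul_right, hv.2 hc]; simp
    · simp
  · refine ext_of_isospectral h fun a x hx => ?_
    change ψ ((ψ†) x) = ρ x
    rw [hψρ, hx]
    -- Eigenvectors for different eigenvalues are orthogonal, so only the block of the eigenvalue of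
    -- x survives in the sum, and none if x lies in the kernel.
    have horth (c : Σ j, Fin (σ.mult j)) (hc : some c.1 ≠ a) : inner ℂ (v c) x = 0 := by
      have := hsymm (v c) x
      simp only [ContinuousLinearMap.coe_coe, hρv, hx, inner_smul_left, inner_smul_right,
        Complex.conj_ofReal] at this
      rw [← sub_eq_zero, ← sub_mul, mul_eq_zero, sub_eq_zero] at this
      exact this.resolve_left fun he => hc (ofReal_node_injective σ he)
    rw [Fintype.sum_sigma]
    rcases a with _ | j
    · simp only [node, Complex.ofReal_zero, zero_smul]
      exact Finset.sum_eq_zero fun i _ => Finset.sum_eq_zero fun k _ => by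
        rw [horth _ (by simp)]; simp
    · rw [Finset.sum_eq_single j]
      · have hxj : x ∈ Module.End.eigenspace (ρ : H →ₗ[ℂ] H) (σ.eig j : ℂ) :=
          Module.End.mem_eigenspace_iff.2 hx
        have := congrArg Subtype.val ((b j).sum_repr' ⟨x, hxj⟩)
        simp only [Submodule.coe_sum, Submodule.coe_smul, Submodule.coe_inner] at this
        simp only [node, ← Finset.smul_sum]
        congr 1
      · intro i _ hi
        exact Finset.sum_eq_zero fun k _ => by
          rw [horth _ (by simpa using hi)]; simp
      · simp

/-- Conjugation by a unitary operator preserves the spectrum. -/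
theorem conj_mem_isospectral {σ : Spectrum} {ρ : H →L[ℂ] H} (h : ρ ∈ isospectral H σ)
    {U : H →L[ℂ] H} (hU : U ∈ unitary (H →L[ℂ] H)) : U * ρ * star U ∈ isospectral H σ := by
  have h1 : star U * U = 1 := Unitary.star_mul_self_of_mem hU
  have h2 : U * star U = 1 := Unitary.mul_star_self_of_mem hU
  let L : H ≃ₗ[ℂ] H := LinearEquiv.ofLinearMap (U : H →ₗ[ℂ] H) (star U : H →L[ℂ] H)
    (by ext x; exact congrArg (fun T : H →L[ℂ] H => T x) h2)
    (by ext x; exact congrArg (fun T : H →L[ℂ] H => T x) h1)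
  have hL (x : H) : L x = U x := rfl
  have hU' (x : H) : star U (U x) = x := congrArg (fun T : H →L[ℂ] H => T x) h1
  have hmap (μ : ℂ) : Module.End.eigenspace ((U * ρ * star U : H →L[ℂ] H) : H →ₗ[ℂ] H) μ =
      (Module.End.eigenspace (ρ : H →ₗ[ℂ] H) μ).map (L : H →ₗ[ℂ] H) := by
    ext y
    obtain ⟨x, rfl⟩ := L.surjective y
    have e : (U * ρ * star U) (L x) = L (ρ x) := by
      change U (ρ (star U (U x))) = U (ρ x)
      rw [hU']
    rw [Module.End.mem_eigenspace_iff, ContinuousLinearMap.coe_coe, e, ← map_smul,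
      L.injective.eq_iff]
    constructor
    · exact fun hx => ⟨x, Module.End.mem_eigenspace_iff.2 hx, rfl⟩
    · rintro ⟨z, hz, hzx⟩
      rw [← L.injective hzx]
      exact Module.End.mem_eigenspace_iff.1 hz
  have hrank (μ : ℂ) : Module.finrank ℂ
      (Module.End.eigenspace ((U * ρ * star U : H →L[ℂ] H) : H →ₗ[ℂ] H) μ) =
      Module.finrank ℂ (Module.End.eigenspace (ρ : H →ₗ[ℂ] H) μ) := by
    rw [hmap]; exact LinearEquiv.finrank_map_eq L _
  refine ⟨h.1.conj_adjoint U, ?_, fun j => by rw [hrank, h.2.2.1], fun μ hμ hev => ?_⟩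
  · rw [tr_mul_comm, ← mul_assoc, h1, one_mul, h.2.1]
  · refine h.2.2.2 μ hμ ?_
    rw [Module.End.hasEigenvalue_iff] at hev ⊢
    intro hbot
    exact hev (by rw [hmap, hbot, Submodule.map_bot])

/-- Purifications of ρ₀ and ρ₁ have the same Gram operator P(σ), so ψ₀x ↦ ψ₁x is an isometry on the
range of ψ₀; in finite dimension it extends to a unitary. -/
theorem exists_unitary_conj_eq {σ : Spectrum} {ρ₀ ρ₁ : H →L[ℂ] H} (h₀ : ρ₀ ∈ isospectral H σ)
    (h₁ : ρ₁ ∈ isospectral H σ) :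
    ∃ U ∈ unitary (H →L[ℂ] H), U * ρ₀ * star U = ρ₁ := by
  obtain ⟨ψ₀, hψ₀, rfl⟩ := exists_purification h₀
  obtain ⟨ψ₁, hψ₁, rfl⟩ := exists_purification h₁
  obtain ⟨Q, hQ, hQ2⟩ := exists_specOp_inverse σ
  have hψ₀ : ψ₀† ∘L ψ₀ = specOp σ := hψ₀
  have hψ₁ : ψ₁† ∘L ψ₁ = specOp σ := hψ₁
  have hnorm (x) : ‖ψ₁ x‖ = ‖ψ₀ x‖ := by
    have e : inner ℂ (ψ₁ x) (ψ₁ x) = inner ℂ (ψ₀ x) (ψ₀ x) := by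
      rw [← ContinuousLinearMap.adjoint_inner_right, ← ContinuousLinearMap.adjoint_inner_right ψ₀,
        ← ContinuousLinearMap.comp_apply, ← ContinuousLinearMap.comp_apply, hψ₀, hψ₁]
    rw [inner_self_eq_norm_sq_to_K, inner_self_eq_norm_sq_to_K] at e
    have e' : ‖ψ₁ x‖ ^ 2 = ‖ψ₀ x‖ ^ 2 := by exact_mod_cast e
    exact (pow_left_inj₀ (norm_nonneg _) (norm_nonneg _) two_ne_zero).1 e'
  -- Since Q inverts P(σ) = ψ₀†ψ₀, `Q ∘L ψ₀†` is a left inverse of ψ₀.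
  let W : H →L[ℂ] H := ψ₁ ∘L Q ∘L ψ₀†
  have hW (x) : W (ψ₀ x) = ψ₁ x := by
    have : Q ((ψ₀†) (ψ₀ x)) = x := by
      have e : (ψ₀†) (ψ₀ x) = specOp σ x := congrArg (fun T : Aux σ →L[ℂ] Aux σ => T x) hψ₀
      rw [e]
      exact congrArg (fun T : Aux σ →L[ℂ] Aux σ => T x) hQ2
    exact congrArg ψ₁ this
  let L : LinearMap.range (ψ₀ : Aux σ →ₗ[ℂ] H) →ₗᵢ[ℂ] H :=
    { toLinearMap := (W : H →ₗ[ℂ] H).comp (Submodule.subtype _)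
      norm_map' := by
        rintro ⟨_, x, rfl⟩
        change ‖W (ψ₀ x)‖ = ‖ψ₀ x‖
        rw [hW, hnorm] }
  let U : H →L[ℂ] H := L.extend.toContinuousLinearMap
  have hUψ : U ∘L ψ₀ = ψ₁ := by
    ext1 x
    have := L.extend_apply ⟨ψ₀ x, x, rfl⟩
    exact this.trans (hW x)
  have hU1 : star U * U = 1 :=
    (ContinuousLinearMap.norm_map_iff_adjoint_comp_self U).1 L.extend.norm_map
  have hU2 : U * star U = 1 := by
    have : (star U : H →L[ℂ] H).toLinearMap * U.toLinearMap = 1 :=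
      congrArg (fun C : H →L[ℂ] H => (C : H →ₗ[ℂ] H)) hU1
    exact ContinuousLinearMap.coe_injective (mul_eq_one_comm.1 this)
  refine ⟨U, Unitary.mem_iff.2 ⟨hU1, hU2⟩, ?_⟩
  change (U ∘L ψ₀ ∘L ψ₀†) ∘L U† = _
  rw [proj, ← hUψ, ContinuousLinearMap.adjoint_comp]
  rfl

/-- A unitary operator is, up to a phase, the exponential of a skew-adjoint operator. -/
theorem exists_selfAdjoint_exp {U : H →L[ℂ] H} (hU : U ∈ unitary (H →L[ℂ] H)) :
    ∃ (z : ℂ) (K : H →L[ℂ] H), IsSelfAdjoint K ∧ z * star z = 1 ∧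
      z • U = NormedSpace.exp (Complex.I • K) := by
  have hfin : (spectrum ℂ U).Finite := by
    have := AlgEquiv.spectrum_eq (Module.End.toContinuousLinearMap (𝕜 := ℂ) H) (U : H →ₗ[ℂ] H)
    exact this ▸ Module.End.finite_spectrum (K := ℂ) (U : H →ₗ[ℂ] H)
  have hinf : (Metric.sphere (0 : ℂ) 1).Infinite := by
    refine Set.infinite_of_injOn_mapsTo (f := fun t : ℝ => (Circle.exp t : ℂ))
      (s := Set.Ioc (-Real.pi) Real.pi) ?_ (fun t _ => by simp)
      (Set.Ioc_infinite (by linarith [Real.pi_pos]))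
    intro s hs t ht hst
    rw [← Circle.arg_exp hs.1 hs.2, ← Circle.arg_exp ht.1 ht.2]
    exact congrArg Complex.arg hst
  -- The finite spectrum misses a point w of the circle. Multiplying by −w⁻¹ moves this gap to −1,
  -- where the principal argument has its cut.
  obtain ⟨w, hw, hwU⟩ := (hinf.sdiff hfin).nonempty
  have hw1 : ‖w‖ = 1 := by simpa using hw
  have hw0 : w ≠ 0 := by rintro rfl; simp at hw1
  have hz : -w⁻¹ * star (-w⁻¹) = 1 := by
    rw [Complex.star_def, Complex.mul_conj, Complex.normSq_eq_norm_sq, norm_neg, norm_inv, hw1]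
    simp
  have hzU : -w⁻¹ • U ∈ unitary (H →L[ℂ] H) := by
    rw [Unitary.mem_iff, star_smul, smul_mul_smul_comm, smul_mul_smul_comm, hz, mul_comm, hz,
      Unitary.star_mul_self_of_mem hU, Unitary.mul_star_self_of_mem hU, one_smul]
    exact ⟨rfl, rfl⟩
  have hsp : -1 ∉ spectrum ℂ (-w⁻¹ • U) := by
    have e := spectrum.unit_smul_eq_smul U (Units.mk0 (-w⁻¹) (neg_ne_zero.2 (inv_ne_zero hw0)))
    rw [Units.smul_def, Units.val_mk0] at e
    rw [e]
    rintro ⟨s, hs, hsw⟩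
    have hsw' : -w⁻¹ * s = -1 := hsw
    have : s = w := by
      field_simp at hsw'
      linear_combination -hsw'
    exact hwU (this ▸ hs)
  have hlt := (Unitary.norm_sub_one_lt_two_iff hzU).2 hsp
  refine ⟨-w⁻¹, Unitary.argSelfAdjoint ⟨_, hzU⟩, (Unitary.argSelfAdjoint _).2, hz, ?_⟩
  have := expUnitary_argSelfAdjoint (u := ⟨_, hzU⟩) hlt
  exact (congrArg Subtype.val this).symm

end

/-! ### Von Neumann evolutions: existence and length bound. -/

noncomputable section

set_option linter.unusedSectionVars false

variable {H : Type*} [NormedAddCommGroup H] [InnerProductSpace ℂ H] [CompleteSpace H]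
  [FiniteDimensional ℂ H] {σ : Spectrum} {ρ₀ ρ₁ : H →L[ℂ] H}

theorem hamField_I_mul_smul {ħ : ℝ} (hħ : 0 < ħ) (x ρ : H →L[ℂ] H) :
    hamField ħ ((Complex.I * (ħ : ℂ)) • x) ρ = x * ρ - ρ * x := by
  have h : Complex.I * (ħ : ℂ) ≠ 0 :=
    mul_ne_zero Complex.I_ne_zero (by exact_mod_cast hħ.ne')
  rw [hamField, ContinuousLinearMap.smul_comp, ContinuousLinearMap.comp_smul, ← smul_sub,
    smul_smul, one_div_mul_cancel h, one_smul]
  rfl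

theorem isSelfAdjoint_I_mul_smul (ħ : ℝ) {x : H →L[ℂ] H} (hx : star x = -x) :
    IsSelfAdjoint ((Complex.I * (ħ : ℂ)) • x) := by
  rw [isSelfAdjoint_iff, star_smul, hx]
  simp

/-- Any two density operators with the same spectrum are joined by a von Neumann evolution with a
constant Hamiltonian. -/
theorem exists_isVonNeumann (h₀ : ρ₀ ∈ isospectral H σ) (h₁ : ρ₁ ∈ isospectral H σ) {ħ τ : ℝ}
    (hħ : 0 < ħ) (hτ : 0 < τ) : ∃ A ρ : ℝ → H →L[ℂ] H, IsVonNeumann ħ σ τ ρ₀ ρ₁ A ρ := by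
  obtain ⟨U, hU, hUρ⟩ := exists_unitary_conj_eq h₀ h₁
  obtain ⟨z, K, hK, hz, hexp⟩ := exists_selfAdjoint_exp hU
  -- Normalized so that exp(τx) = zU; the phase z cancels in the conjugation of ρ₀. The Hamiltonian
  -- iħx cancels the 1/(iħ) in the equation.
  set x : H →L[ℂ] H := τ⁻¹ • Complex.I • K with hx
  have hxs : star x = -x := by
    rw [hx, star_smul, star_smul, hK.star_eq]
    simp
  set V : ℝ → H →L[ℂ] H := fun t => NormedSpace.exp (t • x) with hV
  have hVe (t : ℝ) : t • x = Complex.I • ((t * τ⁻¹) • K) := by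
    rw [hx, smul_smul, smul_comm]
  have hVu (t : ℝ) : V t ∈ unitary (H →L[ℂ] H) := by
    have hs : IsSelfAdjoint ((t * τ⁻¹) • K) := IsSelfAdjoint.smul (.all _) hK
    have := (selfAdjoint.expUnitary ⟨_, hs⟩).2
    rw [selfAdjoint.expUnitary_coe] at this
    simpa only [hV, hVe t] using this
  have hVd (t : ℝ) : HasDerivAt V (x * V t) t := hasDerivAt_exp_smul_const' x t
  have hVd' (t : ℝ) : HasDerivAt (fun t => star (V t)) (-(star (V t) * x)) t := by
    have := (hVd t).star
    rwa [star_mul, hxs, mul_neg] at this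
  refine ⟨fun _ => (Complex.I * (ħ : ℂ)) • x, fun t => V t * ρ₀ * star (V t),
    fun t _ => isSelfAdjoint_I_mul_smul ħ hxs, continuousOn_const,
    fun t _ => conj_mem_isospectral h₀ (hVu t), fun t _ => ?_, ?_, ?_⟩
  · have := (((hVd t).mul_const ρ₀).mul (hVd' t)).hasDerivWithinAt (s := Set.Icc 0 τ)
    rw [hamField_I_mul_smul hħ]
    refine this.congr_deriv ?_
    noncomm_ring
  · simp [hV]
  · have hVτ : V τ = z • U := by
      rw [hexp]
      simp only [hV, hVe τ, mul_inv_cancel₀ hτ.ne', one_smul]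
    rw [hVτ, star_smul, smul_mul_assoc, smul_mul_smul_comm, hz, one_smul, hUρ]

theorem continuousOn_hamField {ħ τ : ℝ} {A ρ : ℝ → H →L[ℂ] H}
    (h : IsVonNeumann ħ σ τ ρ₀ ρ₁ A ρ) :
    ContinuousOn (fun t => hamField ħ (A t) (ρ t)) (Set.Icc 0 τ) := by
  have hρ : ContinuousOn ρ (Set.Icc 0 τ) := fun t ht => (h.eqn t ht).continuousWithinAt
  exact ((h.continuousOn.mul hρ).sub (hρ.mul h.continuousOn)).const_smul
    (1 / (Complex.I * (ħ : ℂ)))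

theorem IsVonNeumann.derivWithin_eq {ħ τ : ℝ} (hτ : 0 < τ) {A ρ : ℝ → H →L[ℂ] H}
    (h : IsVonNeumann ħ σ τ ρ₀ ρ₁ A ρ) {t : ℝ} (ht : t ∈ Set.Icc 0 τ) :
    derivWithin ρ (Set.Icc 0 τ) t = hamField ħ (A t) (ρ t) :=
  (h.eqn t ht).derivWithin (uniqueDiffOn_Icc hτ t ht)

theorem IsVonNeumann.isCurve {ħ τ : ℝ} (hτ : 0 < τ) {A ρ : ℝ → H →L[ℂ] H}
    (h : IsVonNeumann ħ σ τ ρ₀ ρ₁ A ρ) : IsCurve σ τ ρ₀ ρ₁ ρ where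
  contDiffOn := by
    rw [contDiffOn_one_iff_derivWithin (uniqueDiffOn_Icc hτ)]
    exact ⟨fun t ht => (h.eqn t ht).differentiableWithinAt,
      (continuousOn_hamField h).congr fun t ht => h.derivWithin_eq hτ ht⟩
  mem := h.mem
  left := h.left
  right := h.right

theorem IsVonNeumann.continuousOn_uncertainty {ħ τ : ℝ} {A ρ : ℝ → H →L[ℂ] H}
    (h : IsVonNeumann ħ σ τ ρ₀ ρ₁ A ρ) :
    ContinuousOn (fun t => uncertainty (A t) (ρ t)) (Set.Icc 0 τ) := by
  have hρ : ContinuousOn ρ (Set.Icc 0 τ) := fun t ht => (h.eqn t ht).continuousWithinAt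
  have hA := h.continuousOn
  have h1 : ContinuousOn (fun t => (trL H (A t * (A t * ρ t))).re) (Set.Icc 0 τ) :=
    Complex.continuous_re.comp_continuousOn
      ((trL H).continuous.comp_continuousOn (hA.mul (hA.mul hρ)))
  have h2 : ContinuousOn (fun t => (trL H (A t * ρ t)).re) (Set.Icc 0 τ) :=
    Complex.continuous_re.comp_continuousOn ((trL H).continuous.comp_continuousOn (hA.mul hρ))
  exact (h1.sub (h2.pow 2)).sqrt

theorem IsVonNeumann.length_le {c ħ τ : ℝ} (hc : 0 < c) (hħ : 0 < ħ) (hτ : 0 < τ)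
    {A ρ : ℝ → H →L[ℂ] H} (h : IsVonNeumann ħ σ τ ρ₀ ρ₁ A ρ) :
    length c σ τ ρ ≤ √c * energyIntegral ħ τ A ρ := by
  have hintegrable : IntervalIntegrable (fun t => √c * (1 / ħ * uncertainty (A t) (ρ t)))
      MeasureTheory.volume 0 τ := by
    refine ContinuousOn.intervalIntegrable ?_
    rw [Set.uIcc_of_le hτ.le]
    exact (h.continuousOn_uncertainty.const_smul (1 / ħ)).const_smul (√c)
  rw [energyIntegral, ← intervalIntegral.integral_const_mul,
    ← intervalIntegral.integral_const_mul, length, intervalIntegral.integral_of_le hτ.le,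
    intervalIntegral.integral_of_le hτ.le]
  -- Integrability is needed only for the upper bound, so no regularity of the speed has to be
  -- shown.
  refine MeasureTheory.integral_mono_of_nonneg (.of_forall fun t => Real.sqrt_nonneg _) hintegrable.1 ?_
  refine (MeasureTheory.ae_restrict_iff' measurableSet_Ioc).2 (.of_forall fun t ht => ?_)
  have ht' : t ∈ Set.Icc 0 τ := Set.Ioc_subset_Icc_self ht
  have hm := h.mem t ht'
  obtain ⟨ψ, hψ, hψρ⟩ := exists_purification hm
  simp only [h.derivWithin_eq hτ ht']
  rw [← hψρ] at hm ⊢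
  exact sqrt_metric_le hc hħ hψ hm (h.selfAdjoint t ht')

/-- Equality is pointwise in t, so purifications may be chosen independently at each time, without a
continuous lift. -/
theorem IsVonNeumann.length_eq_of_horizontal {c ħ τ : ℝ} (hc : 0 < c) (hħ : 0 < ħ) (hτ : 0 < τ)
    {A ρ : ℝ → H →L[ℂ] H} (h : IsVonNeumann ħ σ τ ρ₀ ρ₁ A ρ)
    (hhor : ∀ t ∈ Set.Icc 0 τ, ∃ ψ ∈ purifications H σ, proj ψ = ρ t ∧
      hamLift ħ (A t) ψ ∈ horizontal c ψ) :
    length c σ τ ρ = √c * energyIntegral ħ τ A ρ := by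
  rw [energyIntegral, ← intervalIntegral.integral_const_mul,
    ← intervalIntegral.integral_const_mul, length]
  refine intervalIntegral.integral_congr fun t ht => ?_
  rw [Set.uIcc_of_le hτ.le] at ht
  obtain ⟨ψ, hψ, hψρ, hX⟩ := hhor t ht
  simp only [h.derivWithin_eq hτ ht]
  rw [← hψρ]
  exact sqrt_metric_of_horizontal hc hħ (h.selfAdjoint t ht) hψ hX

/-! ### The off-diagonal Hamiltonian of a curve. -/

/-- The self-adjoint operator without block diagonal part that generates the velocity `v` at
`ρ`. -/
def horizontalHamiltonian (ħ : ℝ) (σ : Spectrum) (ρ v : H →L[ℂ] H) : H →L[ℂ] H :=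
  (Complex.I * (ħ : ℂ)) • ∑ a, ∑ b,
    -- The commutator with ρ multiplies the (a, b) block by λ_b − λ_a, which this undoes; for a = b
    -- the convention 0⁻¹ = 0 removes the diagonal blocks.
    (((node σ b - node σ a)⁻¹ : ℝ) : ℂ) • (specProj σ a ρ * v * specProj σ b ρ)

section horizontalHamiltonian

variable {ħ : ℝ} {ρ v : H →L[ℂ] H}

theorem isSelfAdjoint_horizontalHamiltonian (hρ : ρ ∈ isospectral H σ) (hv : IsSelfAdjoint v) :
    IsSelfAdjoint (horizontalHamiltonian ħ σ ρ v) := by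
  refine isSelfAdjoint_I_mul_smul ħ ?_
  simp only [star_sum, star_smul, star_mul, hv.star_eq, (isSelfAdjoint_specProj hρ _).star_eq]
  rw [Finset.sum_comm, ← Finset.sum_neg_distrib]
  refine Finset.sum_congr rfl fun a _ => ?_
  rw [← Finset.sum_neg_distrib]
  refine Finset.sum_congr rfl fun b _ => ?_
  rw [← neg_smul, ← mul_assoc, Complex.star_def, Complex.conj_ofReal, ← Complex.ofReal_neg,
    ← inv_neg, neg_sub]

theorem specProj_mul_horizontalHamiltonian_mul (hρ : ρ ∈ isospectral H σ)
    (a : Option (Fin σ.k)) :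
    specProj σ a ρ * horizontalHamiltonian ħ σ ρ v * specProj σ a ρ = 0 := by
  rw [horizontalHamiltonian, mul_smul_comm, smul_mul_assoc]
  simp only [Finset.mul_sum, Finset.sum_mul]
  refine smul_eq_zero_of_right _ (Finset.sum_eq_zero fun b _ => Finset.sum_eq_zero fun c _ => ?_)
  rw [mul_smul_comm, smul_mul_assoc, ← mul_assoc, ← mul_assoc, specProj_mul_specProj hρ,
    mul_assoc _ _ (specProj σ a ρ), specProj_mul_specProj hρ]
  by_cases hab : a = b
  · by_cases hca : c = a
    · subst hab hca; simp
    · simp [hca]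
  · simp [hab]

theorem hamField_horizontalHamiltonian (hħ : 0 < ħ) (hρ : ρ ∈ isospectral H σ)
    (hv : ∀ a, specProj σ a ρ * v * specProj σ a ρ = 0) :
    hamField ħ (horizontalHamiltonian ħ σ ρ v) ρ = v := by
  rw [horizontalHamiltonian, hamField_I_mul_smul hħ]
  conv_rhs => rw [← sum_sum_specProj σ ρ v]
  simp only [Finset.mul_sum, Finset.sum_mul, ← Finset.sum_sub_distrib]
  refine Finset.sum_congr rfl fun a _ => Finset.sum_congr rfl fun b _ => ?_
  by_cases hab : a = b
  · subst hab; simp [hv]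
  have hne : ((node σ b - node σ a : ℝ) : ℂ) ≠ 0 := by
    rw [Complex.ofReal_ne_zero, sub_ne_zero]
    exact fun h => hab (node_injective σ h).symm
  rw [smul_mul_assoc, mul_smul_comm, mul_assoc _ _ ρ, specProj_mul hρ, ← mul_assoc ρ,
    ← mul_assoc ρ, mul_specProj hρ, mul_smul_comm, smul_mul_assoc, smul_mul_assoc, ← smul_sub,
    ← sub_smul, smul_smul, ← Complex.ofReal_sub, Complex.ofReal_inv, inv_mul_cancel₀ hne, one_smul]

end horizontalHamiltonian

/-- The coefficients do not depend on the point of 𝒟(σ), so spectral projections inherit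
differentiability along a curve. -/
theorem differentiableWithinAt_aeval {γ : ℝ → H →L[ℂ] H} {s : Set ℝ} {t : ℝ}
    (h : DifferentiableWithinAt ℝ γ s t) (p : Polynomial ℂ) :
    DifferentiableWithinAt ℝ (fun u => Polynomial.aeval (γ u) p) s t := by
  simp only [Polynomial.aeval_eq_sum_range]
  exact DifferentiableWithinAt.fun_sum fun i _ => (h.fun_pow i).const_smul (p.coeff i)

/-- The velocity of a curve in `𝒟(σ)` has no block diagonal part. -/
theorem IsCurve.specProj_mul_derivWithin_mul {T : ℝ} (hT : 0 < T) {γ : ℝ → H →L[ℂ] H}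
    (h : IsCurve σ T ρ₀ ρ₁ γ) {t : ℝ} (ht : t ∈ Set.Icc 0 T) (a : Option (Fin σ.k)) :
    specProj σ a (γ t) * derivWithin γ (Set.Icc 0 T) t * specProj σ a (γ t) = 0 := by
  have hγ := h.contDiffOn.differentiableOn one_ne_zero t ht
  have hE : HasDerivWithinAt (fun u => specProj σ a (γ u)) _ (Set.Icc 0 T) t :=
    (differentiableWithinAt_aeval hγ (nodePoly σ a)).hasDerivWithinAt
  set E' := derivWithin (fun u => Polynomial.aeval (γ u) (nodePoly σ a)) (Set.Icc 0 T) t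
  have h1 := hγ.hasDerivWithinAt.fun_mul hE
  have h2 : HasDerivWithinAt (fun u => γ u * specProj σ a (γ u))
      (((node σ a : ℝ) : ℂ) • E') (Set.Icc 0 T) t :=
    (hE.const_smul ((node σ a : ℝ) : ℂ)).congr (fun u hu => mul_specProj (h.mem u hu) a)
      (mul_specProj (h.mem t ht) a)
  -- Differentiating γE = λE gives γ'E + γE' = λE'. Left multiplication by E cancels the terms with
  -- E' and leaves Eγ'E = 0.
  have h3 := (uniqueDiffOn_Icc hT t ht).eq_deriv _ h1 h2
  have h4 := congrArg (specProj σ a (γ t) * ·) h3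
  simp only [mul_add, ← mul_assoc] at h4
  rwa [specProj_mul (h.mem t ht), mul_smul_comm, smul_mul_assoc, add_eq_right] at h4

theorem IsCurve.isSelfAdjoint_derivWithin {T : ℝ} {γ : ℝ → H →L[ℂ] H}
    (h : IsCurve σ T ρ₀ ρ₁ γ) {t : ℝ} (ht : t ∈ Set.Icc 0 T) :
    IsSelfAdjoint (derivWithin γ (Set.Icc 0 T) t) := by
  rw [isSelfAdjoint_iff, ← derivWithin.star]
  exact derivWithin_congr (fun u hu => (isSelfAdjoint_of_mem_isospectral (h.mem u hu)).star_eq)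
    (isSelfAdjoint_of_mem_isospectral (h.mem t ht)).star_eq

/-- Every curve in `𝒟(σ)` solves the von Neumann equation for the Hamiltonian without block diagonal
part. -/
theorem IsCurve.isVonNeumann {ħ T : ℝ} (hħ : 0 < ħ) (hT : 0 < T) {γ : ℝ → H →L[ℂ] H}
    (h : IsCurve σ T ρ₀ ρ₁ γ) : IsVonNeumann ħ σ T ρ₀ ρ₁
      (fun t => horizontalHamiltonian ħ σ (γ t) (derivWithin γ (Set.Icc 0 T) t)) γ where
  selfAdjoint t ht :=
    isSelfAdjoint_horizontalHamiltonian (h.mem t ht) (h.isSelfAdjoint_derivWithin ht)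
  continuousOn := by
    have hd := h.contDiffOn.continuousOn_derivWithin (uniqueDiffOn_Icc hT) le_rfl
    have hE (a) : ContinuousOn (fun t => specProj σ a (γ t)) (Set.Icc 0 T) :=
      (Polynomial.continuous_aeval _).comp_continuousOn h.contDiffOn.continuousOn
    exact ContinuousOn.const_smul (continuousOn_finsetSum _ fun a _ =>
      continuousOn_finsetSum _ fun b _ => (((hE a).mul hd).mul (hE b)).const_smul
        (((node σ b - node σ a)⁻¹ : ℝ) : ℂ)) (Complex.I * (ħ : ℂ))
  mem := h.mem
  eqn t ht := by
    rw [hamField_horizontalHamiltonian hħ (h.mem t ht)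
      (h.specProj_mul_derivWithin_mul hT ht)]
    exact (h.contDiffOn.differentiableOn one_ne_zero t ht).hasDerivWithinAt
  left := h.left
  right := h.right

/-- The off-diagonal Hamiltonian is horizontal at any purification, so every curve attains its own
bound; this drives the lower estimate for the distance. -/
theorem IsCurve.length_eq {c ħ T : ℝ} (hc : 0 < c) (hħ : 0 < ħ) (hT : 0 < T)
    {γ : ℝ → H →L[ℂ] H} (h : IsCurve σ T ρ₀ ρ₁ γ) :
    length c σ T γ = √c * energyIntegral ħ T
      (fun t => horizontalHamiltonian ħ σ (γ t) (derivWithin γ (Set.Icc 0 T) t)) γ := by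
  refine (h.isVonNeumann hħ hT).length_eq_of_horizontal hc hħ hT fun t ht => ?_
  have hm := h.mem t ht
  obtain ⟨ψ, hψ, hψρ⟩ := exists_purification hm
  rw [← hψρ] at hm
  refine ⟨ψ, hψ, hψρ, hamLift_mem_horizontal c ħ hm hψ ?_ fun a => ?_⟩
  · exact (h.isVonNeumann hħ hT).selfAdjoint t ht
  · rw [hψρ] at hm ⊢
    exact specProj_mul_horizontalHamiltonian_mul hm a

/-! ### Change of duration and the infimum. -/

theorem uncertainty_smul {r : ℝ} (hr : 0 ≤ r) (A ρ : H →L[ℂ] H) :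
    uncertainty (r • A) ρ = r * uncertainty A ρ := by
  have e1 : tr ((r • A) ∘L (r • A) ∘L ρ) = ((r ^ 2 : ℝ) : ℂ) * tr (A ∘L A ∘L ρ) := by
    rw [show (r • A) ∘L (r • A) ∘L ρ = ((r ^ 2 : ℝ) : ℂ) • (A ∘L A ∘L ρ) by
      ext x; simp [smul_smul, sq, ← Complex.coe_smul], ← trL_apply, map_smul]; rfl
  have e2 : tr ((r • A) ∘L ρ) = (r : ℂ) * tr (A ∘L ρ) := by
    rw [show (r • A) ∘L ρ = (r : ℂ) • (A ∘L ρ) by ext x; simp, ← trL_apply, map_smul]; rfl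
  rw [uncertainty, uncertainty, e1, e2, Complex.re_ofReal_mul, Complex.re_ofReal_mul, mul_pow,
    ← mul_sub, Real.sqrt_mul (sq_nonneg r), Real.sqrt_sq hr]

/-- Reparametrizing a von Neumann evolution to another time interval. -/
theorem IsVonNeumann.rescale {ħ T τ : ℝ} (hT : 0 < T) (hτ : 0 < τ) {A ρ : ℝ → H →L[ℂ] H}
    (h : IsVonNeumann ħ σ T ρ₀ ρ₁ A ρ) :
    IsVonNeumann ħ σ τ ρ₀ ρ₁ (fun t => (T / τ) • A (T / τ * t)) (fun t => ρ (T / τ * t)) := by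
  have hmaps : Set.MapsTo (fun t => T / τ * t) (Set.Icc 0 τ) (Set.Icc 0 T) := fun t ht =>
    ⟨by have := ht.1; positivity, by
      calc T / τ * t ≤ T / τ * τ := by gcongr; exact ht.2
        _ = T := div_mul_cancel₀ _ hτ.ne'⟩
  refine ⟨fun t ht => IsSelfAdjoint.smul (.all _) (h.selfAdjoint _ (hmaps ht)), ?_,
    fun t ht => h.mem _ (hmaps ht), fun t ht => ?_, ?_, ?_⟩
  · exact (h.continuousOn.comp (by fun_prop) hmaps).const_smul (T / τ)
  · have hd : HasDerivWithinAt (fun t => T / τ * t) (T / τ) (Set.Icc 0 τ) t := by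
      simpa using (hasDerivWithinAt_id t (Set.Icc 0 τ)).const_mul (T / τ)
    have := (h.eqn _ (hmaps ht)).scomp t hd hmaps
    refine this.congr_deriv ?_
    rw [hamField, hamField, ContinuousLinearMap.smul_comp, ContinuousLinearMap.comp_smul,
      ← smul_sub, smul_comm]
  · simpa using h.left
  · simpa [div_mul_cancel₀ _ hτ.ne'] using h.right

/-- The uncertainty is homogeneous of degree one in the Hamiltonian, so the factor T/τ is exactly
the Jacobian. The distance admits curves of any duration, while τ is fixed. -/
theorem energyIntegral_rescale (ħ : ℝ) {T τ : ℝ} (hT : 0 < T) (hτ : 0 < τ)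
    (A ρ : ℝ → H →L[ℂ] H) :
    energyIntegral ħ τ (fun t => (T / τ) • A (T / τ * t)) (fun t => ρ (T / τ * t)) =
      energyIntegral ħ T A ρ := by
  have hr : 0 < T / τ := by positivity
  simp only [energyIntegral, uncertainty_smul hr.le]
  rw [intervalIntegral.integral_const_mul,
    intervalIntegral.mul_integral_comp_mul_left (f := fun t => uncertainty (A t) (ρ t)), mul_zero,
    div_mul_cancel₀ _ hτ.ne']

theorem length_nonneg (c : ℝ) (σ : Spectrum) {T : ℝ} (hT : 0 ≤ T) (γ : ℝ → H →L[ℂ] H) :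
    0 ≤ length c σ T γ :=
  intervalIntegral.integral_nonneg hT fun _ _ => Real.sqrt_nonneg _

theorem isGLB_energyIntegral {c ħ τ : ℝ} (hc : 0 < c) (hħ : 0 < ħ) (hτ : 0 < τ)
    (h₀ : ρ₀ ∈ isospectral H σ) (h₁ : ρ₁ ∈ isospectral H σ) :
    IsGLB {r | ∃ A ρ : ℝ → H →L[ℂ] H, IsVonNeumann ħ σ τ ρ₀ ρ₁ A ρ ∧
      r = √c * energyIntegral ħ τ A ρ} (geodesicDist c σ ρ₀ ρ₁) := by
  constructor
  · rintro _ ⟨A, ρ, h, rfl⟩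
    refine (csInf_le ⟨0, ?_⟩ ?_).trans (h.length_le hc hħ hτ)
    · rintro _ ⟨T, hT, γ, -, rfl⟩
      exact length_nonneg c σ hT.le γ
    · exact ⟨τ, hτ, ρ, h.isCurve hτ, rfl⟩
  · intro b hb
    -- Some connecting curve must exist before a lower bound can be compared with the real `sInf`,
    -- which is 0 on the empty set.
    obtain ⟨A, ρ, h⟩ := exists_isVonNeumann h₀ h₁ hħ hτ
    refine le_csInf ⟨_, τ, hτ, ρ, h.isCurve hτ, rfl⟩ ?_
    rintro _ ⟨T, hT, γ, hγ, rfl⟩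
    rw [hγ.length_eq hc hħ hT, ← energyIntegral_rescale ħ hT hτ]
    exact hb ⟨_, _, (hγ.isVonNeumann hħ hT).rescale hT hτ, rfl⟩

end

end MixedState

open MixedState in
theorem mainTheorem3 {H : Type*} [NormedAddCommGroup H] [InnerProductSpace ℂ H] [CompleteSpace H]
    [FiniteDimensional ℂ H] (σ : Spectrum) (ħ : ℝ) (hħ : 0 < ħ) (τ : ℝ) (hτ : 0 < τ)
    (ρ₀ ρ₁ : H →L[ℂ] H) (h₀ : ρ₀ ∈ isospectral H σ) (h₁ : ρ₁ ∈ isospectral H σ) :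
    -- the distance is the infimum of the energy-uncertainty integrals
    IsGLB {r | ∃ A ρ : ℝ → H →L[ℂ] H, IsVonNeumann ħ σ τ ρ₀ ρ₁ A ρ ∧ r = energyIntegral ħ τ A ρ}
      (geodesicDist 1 σ ρ₀ ρ₁) ∧
    -- each integral bounds the length of its curve
    (∀ A ρ : ℝ → H →L[ℂ] H, IsVonNeumann ħ σ τ ρ₀ ρ₁ A ρ →
      length 1 σ τ ρ ≤ energyIntegral ħ τ A ρ) ∧
    -- with equality if the Hamiltonian generates a horizontal lift
    (∀ A ρ : ℝ → H →L[ℂ] H, IsVonNeumann ħ σ τ ρ₀ ρ₁ A ρ →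
      GeneratesHorizontalLift 1 ħ σ τ A ρ → length 1 σ τ ρ = energyIntegral ħ τ A ρ) ∧
    -- the same for the metric `G(X, Y) = ħ Tr(X†Y + Y†X)`, which rescales all lengths
    IsGLB {r | ∃ A ρ : ℝ → H →L[ℂ] H, IsVonNeumann ħ σ τ ρ₀ ρ₁ A ρ ∧
      r = √(2 * ħ) * energyIntegral ħ τ A ρ} (geodesicDist (2 * ħ) σ ρ₀ ρ₁) := by
  -- The last claim is the case c = 2ħ; the others have c = 1. Existence of pairs is implicit in
  -- `IsGLB`, since the empty set of reals has no greatest lower bound.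
  refine ⟨?_, fun A ρ h => ?_, fun A ρ h hlift => ?_,
    isGLB_energyIntegral (by positivity) hħ hτ h₀ h₁⟩
  · simpa using isGLB_energyIntegral one_pos hħ hτ h₀ h₁
  · simpa using h.length_le one_pos hħ hτ
  · obtain ⟨ψ, hψ⟩ := hlift
    simpa using h.length_eq_of_horizontal one_pos hħ hτ fun t ht =>
      ⟨ψ t, (hψ t ht).1, (hψ t ht).2.1, (hψ t ht).2.2.2⟩
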